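/- Let $\mathcal G=(V,\mathcal E)$ be a connected, locally finite simple graph with countable vertex set, let $(a_{x,y})_{\{x,y\}\in\mathcal E}$ be symmetric positive conductances, put $a_x=\sum_{z\sim x}a_{x,z}$, and let $X$ be the Markov chain on $V$ with $p_{x,y}=a_{x,y}/a_x$ if $x\sim y$ and $p_{x,y}=0$ otherwise, with law $P_x$ when started from $x$. Assume that $X$ is transient. Let $W$ be the set of nearest-neighbour trajectories $(w_n)_{n\in\mathbb Z}$ that visit every vertex finitely often, with the $\sigma$-algebra generated by the coordinates, let $W^*$ be its quotient by time shifts, with the quotient $\sigma$-algebra $\mathcal W^*$, and $\pi^*:W\to W^*$ the projection. For finite $K\subset V$ let $W_K\subset W$ be the set of trajectories that visit $K$, and $W_K^*=\pi^*(W_K)$. With $\tau_K^+=\inf\{n\ge1: X_n\in K\}$ and $e_K(x)=a_xP_x[\tau_K^+=\infty]$ for $x\in K$, $e_K(x)=0$ for $x\notin K$, let $\nu_K$ be the measure on $W$ given by $$\nu_K\big((w_{-n})_{n\ge0}\in A,\ w_0=x,\ (w_n)_{n\ge0}\in B\big)=P_x[A\mid\tau_K^+=\infty]\,e_K(x)\,P_x[B],$$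 and let $\nu$ be the measure on $W^*$ whose restriction to $W_K^*$ is $\nu_K\circ(\pi^*)^{-1}$ for every finite $K$. Let $\Omega$ be the set of at most countable sums $\omega=\sum_i\delta_{w_i^*}$ of point masses on $W^*$ with $\omega(W_K^*)<\infty$ for all finite $K$, with the $\sigma$-algebra generated by the maps $\omega\mapsto\omega(D)$, $D\in\mathcal W^*$, and the order: $\omega\le\omega'$ if and only if $\omega(D)\le\omega'(D)$ for all $D\in\mathcal W^*$. The interlacement law $\mathbb P$ is the law on $\Omega$ of a Poisson point process with intensity $\nu$. For finite $K\subset V$ and $w\in W_K$ let $\tau_K(w)$ and $\lambda_K(w)$ be the first and the last time at which $w$ is in $K$, and put $$\mathrm{Out}_{\to K}(w)=(w_{\tau_K(w)+n})_{n\le0},\qquad \mathrm{Out}_{K\to}(w)=(w_{\lambda_K(w)+n})_{n\ge0}.$$ For $\omega=\sum_i\delta_{w_i^*}\in\Omega$, with $w_i$ any representative of $w_i^*$, let $$\widetilde{\mathrm{Out}}_K(\omega)=\sum_{i:\,w_i^*\in W_K^*}\delta_{\mathrm{Out}_{\to K}(w_i)}+\sum_{i:\,w_i^*\in W_K^*}\delta_{\mathrm{Out}_{K\to}(w_i)}+\sum_{i:\,w_i^*\notin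 W_K^*}\delta_{w_i^*},$$ a point measure on the disjoint union of the spaces of incoming pieces, of outgoing pieces, and $W^*$, and let $\widetilde{\mathcal T}_{RI}=\bigcap_{K}\sigma(\widetilde{\mathrm{Out}}_K)$, the intersection being over all finite $K\subset V$. Then every increasing event $E\in\widetilde{\mathcal T}_{RI}$ (that is, $\omega\in E$ and $\omega\le\omega'$ imply $\omega'\in E$) satisfies $\mathbb P(E)\in\{0,1\}$. -/

import Mathlib

open MeasureTheory ProbabilityTheory
open scoped ENNReal NNReal

namespace Interlacement

noncomputable section

/-! ### The reversible Markov chain of a weighted graph -/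

section Chain

variable {V : Type*} (G : SimpleGraph V) [G.LocallyFinite] (a : V → V → ℝ≥0)

/-- The total conductance `a_x = ∑_{z ∼ x} a_{x,z}` at a vertex. -/
def totalWeight (x : V) : ℝ≥0 := ∑ z ∈ G.neighborFinset x, a x z

variable [MeasurableSpace V] [DiscreteMeasurableSpace V]

open Classical in
/-- The transition kernel `p_{x,y} = a_{x,y} / a_x` for `y ∼ x`, and `0` for other `y`.
(If `a_x = 0`, which for positive conductances on a connected graph happens only when `x` is the
only vertex, the chain stays put; it is then not transient.) -/
def step : Kernel V V where
  toFun x :=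
    if totalWeight G a x = 0 then Measure.dirac x
    else ∑ y ∈ G.neighborFinset x,
      ((a x y : ℝ≥0∞) / (totalWeight G a x : ℝ≥0∞)) • Measure.dirac y
  measurable' := Measurable.of_discrete

instance : IsMarkovKernel (step G a) := by
  classical
  refine ⟨fun x => ⟨?_⟩⟩
  by_cases h : totalWeight G a x = 0
  · simp [step, h]
  · have h' : (totalWeight G a x : ℝ≥0∞) ≠ 0 := by exact_mod_cast h
    simp only [step, Kernel.coe_mk, h, if_false, Measure.coe_finsetSum, Finset.sum_apply,
      Measure.smul_apply, measure_univ, smul_eq_mul, mul_one, div_eq_mul_inv]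
    rw [← Finset.sum_mul, ← ENNReal.ofNNReal_finsetSum]
    exact ENNReal.mul_inv_cancel h' ENNReal.coe_ne_top

/-- The law `P_x` of the chain started from `x`, as a measure on the space of sequences
`ℕ → V`. -/
def walkLaw (x : V) : Measure (ℕ → V) :=
  Kernel.traj (X := fun _ => V)
    (fun n => (step G a).comap (fun h : (i : Finset.Iic n) → V => h ⟨n, Finset.mem_Iic.2 le_rfl⟩)
      (measurable_pi_apply _)) 0 (fun _ => x)

/-- The chain is transient: started from any vertex, it almost surely visits this vertex only
finitely many times. -/
def IsTransient : Prop :=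
  ∀ x : V, ∀ᵐ w ∂(walkLaw G a x), {n : ℕ | w n = x}.Finite

/-- The event `{τ_K^+ = ∞}` that a path does not visit `K` at times `n ≥ 1`. -/
def noReturn (K : Finset V) : Set (ℕ → V) := {w | ∀ n, 1 ≤ n → w n ∉ K}

/-- The equilibrium measure `e_K(x) = a_x P_x[τ_K^+ = ∞]` at a point `x ∈ K`. -/
def equilibrium (K : Finset V) (x : V) : ℝ≥0∞ :=
  (totalWeight G a x : ℝ≥0∞) * walkLaw G a x (noReturn K)

end Chain

/-! ### Biinfinite trajectories, and trajectories up to time shift -/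

section Trajectories

variable {V : Type*} (G : SimpleGraph V)

/-- The space `W` of transient nearest-neighbour trajectories indexed by `ℤ`, with the σ-algebra
generated by the coordinate maps. -/
abbrev Traj : Type _ :=
  {w : ℤ → V // (∀ n, G.Adj (w n) (w (n + 1))) ∧ ∀ x, {n : ℤ | w n = x}.Finite}

/-- Two trajectories are equivalent if they differ by a time shift. -/
def shiftSetoid : Setoid (Traj G) where
  r w w' := ∃ k : ℤ, ∀ n, w.1 (n + k) = w'.1 n
  iseqv :=
    { refl := fun w => ⟨0, fun n => by simp⟩
      symm := fun {w w'} ⟨k, hk⟩ => ⟨-k, fun n => by rw [← hk, neg_add_cancel_right]⟩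
      trans := fun {w w' w''} ⟨k, hk⟩ ⟨l, hl⟩ =>
        ⟨l + k, fun n => by rw [← hl, ← hk, add_assoc]⟩ }

/-- The space `W^*` of trajectories up to time shift, with the quotient σ-algebra: `D` is measurable
iff its preimage in `W` is. -/
abbrev TrajMod : Type _ := Quotient (shiftSetoid G)

variable {G}

/-- The projection `π^* : W → W^*`. -/
def proj (w : Traj G) : TrajMod G := Quotient.mk (shiftSetoid G) w

/-- The trajectory `w` visits `K`, i.e. `w ∈ W_K`. -/
def Hits (K : Finset V) (w : Traj G) : Prop := ∃ n, w.1 n ∈ K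

variable (G) in
/-- The set `W_K^*` of trajectories up to time shift that visit `K`. -/
def hitSet (K : Finset V) : Set (TrajMod G) := proj '' {w | Hits K w}

/-- The hitting time `τ_K(w)` (meaningful for `w ∈ W_K`). -/
def hitTime (K : Finset V) (w : Traj G) : ℤ := sInf {n : ℤ | w.1 n ∈ K}

/-- The time `λ_K(w)` of the last visit to `K` (meaningful for `w ∈ W_K`). -/
def lastTime (K : Finset V) (w : Traj G) : ℤ := sSup {n : ℤ | w.1 n ∈ K}

/-- The incoming piece `(w_{τ_K(w) + n})_{n ≤ 0}`, a sequence indexed by the nonpositive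
integers; its entry with index `-n` is stored at `n : ℕ`. -/
def outIn (K : Finset V) (w : Traj G) : ℕ → V := fun n => w.1 (hitTime K w - n)

/-- The outgoing piece `(w_{λ_K(w) + n})_{n ≥ 0}`. -/
def outOut (K : Finset V) (w : Traj G) : ℕ → V := fun n => w.1 (lastTime K w + n)

lemma visits_finite (K : Finset V) (w : Traj G) : {n : ℤ | w.1 n ∈ K}.Finite := by
  have : {n : ℤ | w.1 n ∈ K} = ⋃ x ∈ K, {n : ℤ | w.1 n = x} := by ext n; simp
  rw [this]
  exact K.finite_toSet.biUnion fun x _ => w.2.2 x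

lemma visits_shift {K : Finset V} {w w' : Traj G} {k : ℤ}
    (hk : ∀ n, w.1 (n + k) = w'.1 n) :
    {n : ℤ | w.1 n ∈ K} = (OrderIso.addRight k) '' {n : ℤ | w'.1 n ∈ K} := by
  ext n
  simp only [Set.mem_ofPred_eq, Set.mem_image, OrderIso.addRight_apply]
  constructor
  · intro h
    exact ⟨n - k, by rw [← hk]; simpa using h, by ring⟩
  · rintro ⟨m, hm, rfl⟩
    rwa [hk]

lemma hits_shift {K : Finset V} {w w' : Traj G} {k : ℤ}
    (hk : ∀ n, w.1 (n + k) = w'.1 n) : Hits K w ↔ Hits K w' := by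
  constructor
  · rintro ⟨n, hn⟩
    exact ⟨n - k, by rw [← hk]; simpa using hn⟩
  · rintro ⟨n, hn⟩
    exact ⟨n + k, by rwa [hk]⟩

lemma outIn_shift {K : Finset V} {w w' : Traj G} {k : ℤ}
    (hk : ∀ n, w.1 (n + k) = w'.1 n) (h : Hits K w') : outIn K w = outIn K w' := by
  have h1 : hitTime K w = hitTime K w' + k := by
    rw [hitTime, visits_shift hk,
      ← (OrderIso.addRight k).map_csInf' (show {n : ℤ | w'.1 n ∈ K}.Nonempty from h)
        (visits_finite K w').bddBelow]
    rfl
  funext n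
  rw [outIn, outIn, h1, ← hk, add_sub_right_comm]

lemma outOut_shift {K : Finset V} {w w' : Traj G} {k : ℤ}
    (hk : ∀ n, w.1 (n + k) = w'.1 n) (h : Hits K w') : outOut K w = outOut K w' := by
  have h1 : lastTime K w = lastTime K w' + k := by
    rw [lastTime, visits_shift hk,
      ← (OrderIso.addRight k).map_csSup' (show {n : ℤ | w'.1 n ∈ K}.Nonempty from h)
        (visits_finite K w').bddAbove]
    rfl
  funext n
  rw [outOut, outOut, h1, ← hk, add_right_comm]

end Trajectories

/-! ### The intensity measure -/

section Intensity

variable {V : Type*}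

/-- The biinfinite sequence equal to `p.1` read backwards at nonpositive times and to `p.2` at
positive times. -/
def glue (p : (ℕ → V) × (ℕ → V)) : ℤ → V :=
  fun n => if n ≤ 0 then p.1 (-n).toNat else p.2 n.toNat

variable (G : SimpleGraph V) [G.LocallyFinite] (a : V → V → ℝ≥0)
  [MeasurableSpace V] [DiscreteMeasurableSpace V]

/-- The measure `ν_K` on `W`: it gives to `{(w_{-n})_{n ≥ 0} ∈ A, w_0 = x, (w_n)_{n ≥ 0} ∈ B}` the
mass `P_x[A | τ_K^+ = ∞] e_K(x) P_x[B]` if `x ∈ K`, and mass `0` if `x ∉ K`. It is first built on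
all sequences `ℤ → V`, then restricted to `W`, where it lives when the chain is transient. -/
def nuOn (K : Finset V) : Measure (Traj G) :=
  (∑ x ∈ K, equilibrium G a K x •
    (((cond (walkLaw G a x) (noReturn K)).prod (walkLaw G a x)).map glue)).comap Subtype.val

/-- The intensity measure `ν` on `W^*`. The measures `ν_K ∘ (π^*)⁻¹` increase with `K`, since
`ν_K ∘ (π^*)⁻¹` is the restriction of `ν_L ∘ (π^*)⁻¹` to `W_K^*` whenever `K ⊆ L`; hence their
supremum `ν` is the measure whose restriction to `W_K^*` is `ν_K ∘ (π^*)⁻¹` for every `K`. -/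
def nu : Measure (TrajMod G) := ⨆ K : Finset V, (nuOn G a K).map proj

end Intensity

/-! ### Poisson point processes and the interlacement law -/

/-- Under `P`, the random measure `ξ` is a Poisson point process with intensity `μ`: `ξ(D)` has the
Poisson law of parameter `μ(D)` (and is a.s. infinite if `μ(D) = ∞`), and the random variables
`ξ(D_1), …, ξ(D_m)` are independent if the `D_i` are pairwise disjoint. -/
structure IsPoissonPointProcess {S X : Type*} [MeasurableSpace S] [MeasurableSpace X]
    (μ : Measure X) (ξ : S → Measure X) (P : Measure S) : Prop where
  isProbabilityMeasure : IsProbabilityMeasure P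
  measurable : Measurable ξ
  poisson : ∀ D : Set X, MeasurableSet D → μ D ≠ ∞ →
    P.map (fun s => ξ s D) = (poissonMeasure (μ D).toNNReal).map (fun k : ℕ => (k : ℝ≥0∞))
  infinite : ∀ D : Set X, MeasurableSet D → μ D = ∞ → ∀ᵐ s ∂P, ξ s D = ∞
  indep : ∀ (m : ℕ) (D : Fin m → Set X), (∀ i, MeasurableSet (D i)) →
    Pairwise (Function.onFun Disjoint D) → iIndepFun (fun i s => ξ s (D i)) P

section Config

variable {V : Type*} (G : SimpleGraph V) [MeasurableSpace V]

/-- The space `Ω` of point measures `ω = ∑_i δ_{w_i^*}` on `W^*`, with at most countably many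
points, such that `ω(W_K^*) < ∞` for every finite `K`. Its σ-algebra is the one generated by the maps
`ω ↦ ω(D)` for measurable `D`, and its order is: `ω ≤ ω'` iff `ω(D) ≤ ω'(D)` for every
measurable `D` (both are those of `Measure`, restricted to this subtype). -/
abbrev Config : Type _ :=
  {ω : Measure (TrajMod G) //
    (∃ (I : Set ℕ) (w : I → TrajMod G), ω = Measure.sum fun i => Measure.dirac (w i)) ∧
    ∀ K : Finset V, ω (hitSet G K) < ∞}

/-- `P` is the interlacement law: the law on `Ω` of a Poisson point process with intensity `ν`. -/
def IsInterlacementLaw [DiscreteMeasurableSpace V] [G.LocallyFinite] (a : V → V → ℝ≥0)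
    (P : Measure (Config G)) : Prop :=
  IsPoissonPointProcess (nu G a) (fun ω : Config G => ω.1) P

/-! ### The trace outside a finite set without pairing, and the non-local σ-algebra -/

/-- The disjoint union of the spaces of incoming pieces, of outgoing pieces, and of complete
trajectories up to time shift. -/
abbrev Pieces : Type _ := (ℕ → V) ⊕ ((ℕ → V) ⊕ TrajMod G)

variable {G}

open Classical in
/-- The contribution of one trajectory to the trace outside `K`: a point mass at its incoming piece
plus a point mass at its outgoing piece if it visits `K`, a point mass at the trajectory up to time
shift otherwise. -/
def tracePieces (K : Finset V) (w : Traj G) : Measure (Pieces G) :=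
  if Hits K w then
    Measure.dirac (Sum.inl (outIn K w)) + Measure.dirac (Sum.inr (Sum.inl (outOut K w)))
  else Measure.dirac (Sum.inr (Sum.inr (proj w)))

/-- The contribution of a trajectory up to time shift; any representative gives the same. -/
def tracePiecesMod (K : Finset V) : TrajMod G → Measure (Pieces G) :=
  Quotient.lift (tracePieces K) (by
    rintro w w' ⟨k, hk⟩
    have hp : proj w = proj w' := Quotient.sound (s := shiftSetoid G) ⟨k, hk⟩
    by_cases h : Hits K w'
    · simp only [tracePieces, hits_shift hk, h, if_true, outIn_shift hk h, outOut_shift hk h]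
    · simp only [tracePieces, hits_shift hk, h, if_false, hp])

/-- The trace of `ω = ∑_i δ_{w_i^*}` outside `K` without pairing: the sum over `i` of the
contributions of the `w_i^*`. -/
def outUnpaired (K : Finset V) (ω : Config G) : Measure (Pieces G) :=
  ω.1.bind (tracePiecesMod K)

variable (G) in
/-- The σ-algebra of the non-local events that forget the pairing: the intersection, over all finite
`K`, of the σ-algebras generated by the traces outside `K` without pairing. -/
@[reducible] def unpairedTail : MeasurableSpace (Config G) :=
  ⨅ K : Finset V, MeasurableSpace.comap (outUnpaired K) inferInstance

end Config

end

end Interlacement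

/-!
By the Mecke formula, an event of a Poisson process that is almost surely insensitive to adding one
point has probability `0` or `1`. For an increasing event `E` it is enough to show that adding a
trajectory through a vertex `o` does not increase the probability of `E`.

Run the two ends of a trajectory through `o` up to time `n`, and let them continue in two
independent ways each, `α, α'` and `β', β`. The trajectories through `o` with ends `(α, β)` and
`(β', α')` leave, outside the set `K` of the two positions at time `n`, the same unpaired pieces as
the trajectories `(α, α')` and `(β', β)` that pass through these positions. As `E` is increasing and
does not see the pairing, it occurs after adding the first trajectory only if it occurs after adding
the last two.

These last two are far from `o`: the density of their law with respect to `ν` has a second moment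
bounded, by reversibility and mass transport, by a multiple of the tail `∑ k ≥ 2 * n, p_k(o, o)` of
the Green function. By transience the tail vanishes as `n → ∞`, and by the Cauchy–Schwarz inequality
adding a point with such a law increases a probability by at most the square root of this second
moment.
-/

namespace Interlacement

noncomputable section

/-! ### Poisson point processes -/

section RandomMeasure

variable {X : Type*} [MeasurableSpace X] {ν : Measure X}

lemma measure_eq_iSup_inter_spanningSets (ν μ : Measure X) [SigmaFinite ν] (D : Set X) :
    μ D = ⨆ n, μ (D ∩ spanningSets ν n) := by
  have hmono : Monotone fun n => D ∩ spanningSets ν n := fun _ _ h =>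
    Set.inter_subset_inter_right D (monotone_spanningSets ν h)
  rw [← hmono.measure_iUnion, ← Set.inter_iUnion, iUnion_spanningSets, Set.inter_univ]

lemma inter_spanningSets_measure_ne_top (ν : Measure X) [SigmaFinite ν] (D : Set X) (n : ℕ) :
    ν (D ∩ spanningSets ν n) ≠ ∞ :=
  ((measure_mono Set.inter_subset_right).trans_lt (measure_spanningSets_lt_top ν n)).ne

lemma ext_of_measure_ne_top (ν : Measure X) [SigmaFinite ν] {μ μ' : Measure X}
    (h : ∀ D, MeasurableSet D → ν D ≠ ∞ → μ D = μ' D) : μ = μ' := by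
  ext D hD
  rw [measure_eq_iSup_inter_spanningSets ν μ, measure_eq_iSup_inter_spanningSets ν μ']
  exact iSup_congr fun n => h _ (hD.inter (measurableSet_spanningSets ν n))
    (inter_spanningSets_measure_ne_top ν D n)

lemma comap_eval_measure_ne_top (ν : Measure X) [SigmaFinite ν] :
    MeasurableSpace.comap
      (fun (m : Measure X) (D : {D : Set X // MeasurableSet D ∧ ν D ≠ ∞}) => m D) inferInstance
      = Measure.instMeasurableSpace := by
  set ev := fun (m : Measure X) (D : {D : Set X // MeasurableSet D ∧ ν D ≠ ∞}) => m D
  refine le_antisymm (Measurable.comap_le <| measurable_pi_lambda ev fun D =>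
    Measure.measurable_coe D.2.1) (iSup₂_le fun D hD => Measurable.comap_le ?_)
  simp_rw [measure_eq_iSup_inter_spanningSets ν _ D]
  refine Measurable.iSup fun n => ?_
  exact (measurable_pi_apply (⟨_, hD.inter (measurableSet_spanningSets ν n),
    inter_spanningSets_measure_ne_top ν D n⟩ : {D : Set X // MeasurableSet D ∧ ν D ≠ ∞})).comp
    (comap_measurable ev)

/-- A family of pairwise disjoint measurable sets of finite measure. For a Poisson process with
intensity `ν` the numbers of points in the members of such a family are independent Poisson
variables with finite parameters. -/
structure IsFiniteDisjointFamily {ι : Type*} (ν : Measure X) (C : ι → Set X) : Prop where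
  measurableSet : ∀ i, MeasurableSet (C i)
  disjoint : Pairwise (Function.onFun Disjoint C)
  measure_ne_top : ∀ i, ν (C i) ≠ ∞

/-- The points that belong to exactly those members of `t` that are members of `J`: the atoms of
the algebra of sets generated by `t`. -/
def atom (t J : Finset (Set X)) : Set X := {x | ∀ D ∈ t, x ∈ D ↔ D ∈ J}

lemma measurableSet_atom {t : Finset (Set X)} (ht : ∀ D ∈ t, MeasurableSet D)
    (J : Finset (Set X)) : MeasurableSet (atom t J) := by
  have : atom t J = ⋂ D ∈ t, {x | x ∈ D ↔ D ∈ J} := by ext x; simp [atom]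
  rw [this]
  exact t.measurableSet_biInter fun D hD => (ht D hD).iff (.const _)

lemma IsFiniteDisjointFamily.exists_eq_biUnion {t : Finset (Set X)}
    (ht : ∀ D ∈ t, MeasurableSet D ∧ ν D ≠ ∞) :
    ∃ (m : ℕ) (C : Fin m → Set X), IsFiniteDisjointFamily ν C ∧
      ∀ D ∈ t, ∃ I : Finset (Fin m), D = ⋃ i ∈ I, C i := by
  classical
  set e := (t.powerset.erase ∅).equivFin.symm
  refine ⟨_, fun i => atom t (e i), ⟨fun i => measurableSet_atom (fun D hD => (ht D hD).1) _,
    fun i j hij => Set.disjoint_left.2 fun x hi hj => hij ?_, fun i => ?_⟩, fun D hD =>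
    ⟨Finset.univ.filter fun i => D ∈ (e i).1, ?_⟩⟩
  · have hsub (i) : (e i).1 ⊆ t := Finset.mem_powerset.1 (Finset.mem_of_mem_erase (e i).2)
    refine e.injective (Subtype.ext (Finset.ext fun D => ⟨fun h => ?_, fun h => ?_⟩))
    · exact (hj D (hsub i h)).1 ((hi D (hsub i h)).2 h)
    · exact (hi D (hsub j h)).1 ((hj D (hsub j h)).2 h)
  · obtain ⟨D, hD⟩ := Finset.nonempty_iff_ne_empty.2 (Finset.ne_of_mem_erase (e i).2)
    have hDt : D ∈ t := Finset.mem_powerset.1 (Finset.mem_of_mem_erase (e i).2) hD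
    exact ((measure_mono fun x hx => (hx D hDt).2 hD).trans_lt (ht D hDt).2.lt_top).ne
  · ext x
    simp only [Finset.mem_filter, Finset.mem_univ, true_and, Set.mem_iUnion, exists_prop]
    refine ⟨fun hx => ?_, fun ⟨i, hi, hx⟩ => (hx D hD).2 hi⟩
    have hmem : t.filter (x ∈ ·) ∈ t.powerset.erase ∅ :=
      Finset.mem_erase.2 ⟨Finset.ne_empty_of_mem (Finset.mem_filter.2 ⟨hD, hx⟩),
        Finset.mem_powerset.2 (Finset.filter_subset _ _)⟩
    refine ⟨e.symm ⟨_, hmem⟩, ?_⟩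
    simp +contextual [atom, hD, hx]

lemma IsFiniteDisjointFamily.map_apply_biUnion {m : ℕ} {C : Fin m → Set X}
    (hC : IsFiniteDisjointFamily ν C) {κ : Type*} {D : κ → Set X}
    {I : κ → Finset (Fin m)} (hI : ∀ j, D j = ⋃ i ∈ I j, C i) (Q : Measure (Measure X)) :
    Q.map (fun ω j => ω (D j))
      = (Q.map fun ω i => ω (C i)).map fun y j => ∑ i ∈ I j, y i := by
  rw [Measure.map_map (by fun_prop)
    (measurable_pi_lambda _ fun i => Measure.measurable_coe (hC.measurableSet i))]
  congr 1
  funext ω j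
  rw [hI j, measure_biUnion_finset (fun i _ j _ hij => hC.disjoint hij) fun i _ =>
    hC.measurableSet i]
  rfl

lemma ext_of_map_finiteDisjointFamily [SigmaFinite ν] {Q Q' : Measure (Measure X)}
    [IsFiniteMeasure Q] {D₀ : Set X} (hD₀ : MeasurableSet D₀) (hνD₀ : ν D₀ ≠ ∞)
    (h : ∀ (m : ℕ) (C : Fin m → Set X), IsFiniteDisjointFamily ν C →
      (∃ I : Finset (Fin m), D₀ = ⋃ i ∈ I, C i) →
      Q.map (fun ω i => ω (C i)) = Q'.map fun ω i => ω (C i)) : Q = Q' := by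
  classical
  set ev := fun (ω : Measure X) (D : {D : Set X // MeasurableSet D ∧ ν D ≠ ∞}) => ω D
  have hev : Measurable ev := measurable_pi_lambda _ fun D => Measure.measurable_coe D.2.1
  have hmap : Q.map ev = Q'.map ev := by
    refine IsProjectiveLimit.unique (P := fun t => (Q.map ev).map t.restrict) (fun _ => rfl)
      fun t => ?_
    obtain ⟨m, C, hC, hcover⟩ := IsFiniteDisjointFamily.exists_eq_biUnion (ν := ν)
      (t := insert D₀ (t.image Subtype.val)) fun D hD => by
        rcases Finset.mem_insert.1 hD with rfl | hD
        · exact ⟨hD₀, hνD₀⟩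
        · obtain ⟨D', -, rfl⟩ := Finset.mem_image.1 hD
          exact D'.2
    choose I hI using fun D : t => hcover D.1.1
      (Finset.mem_insert_of_mem (Finset.mem_image_of_mem _ D.2))
    have hrestrict : t.restrict ∘ ev = fun ω (D : t) => ω D.1.1 := rfl
    simp only [Measure.map_map (Finset.measurable_restrict _) hev, hrestrict]
    rw [hC.map_apply_biUnion hI, hC.map_apply_biUnion hI,
      h m C hC (hcover D₀ (Finset.mem_insert_self _ _))]
  ext A hA
  rw [← comap_eval_measure_ne_top ν] at hA
  obtain ⟨B, hB, rfl⟩ := hA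
  rw [← Measure.map_apply hev hB, hmap, Measure.map_apply hev hB]

lemma ext_of_ae_mem_countable {Y : Type*} [MeasurableSpace Y] [MeasurableSingletonClass Y]
    {μ μ' : Measure Y} {R : Set Y} (hR : R.Countable) (hμ : ∀ᵐ y ∂μ, y ∈ R)
    (hμ' : ∀ᵐ y ∂μ', y ∈ R) (h : ∀ y ∈ R, μ {y} = μ' {y}) : μ = μ' := by
  ext A -
  rw [← Measure.measure_inter_eq_of_ae hμ, ← Measure.measure_inter_eq_of_ae hμ']
  have hAR : (R ∩ A).Countable := hR.mono Set.inter_subset_left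
  calc μ (R ∩ A) = ∑' y : ↑(R ∩ A), μ {y.1} :=
        (tsum_measure_preimage_singleton (f := id) hAR fun y _ => measurableSet_singleton y).symm
    _ = ∑' y : ↑(R ∩ A), μ' {y.1} := tsum_congr fun y => h y y.2.1
    _ = μ' (R ∩ A) :=
        tsum_measure_preimage_singleton (f := id) hAR fun y _ => measurableSet_singleton y

/-- The measures that give mass `k i` to `C i` for every `i`; for a point process, the event that
there are `k i` points in each `C i`. -/
def countEvent {ι : Type*} (C : ι → Set X) (k : ι → ℕ) : Set (Measure X) :=
  {ω | ∀ i, ω (C i) = k i}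

lemma IsFiniteDisjointFamily.measurableSet_countEvent {ι : Type*} [Countable ι] {C : ι → Set X}
    (hC : IsFiniteDisjointFamily ν C) (k : ι → ℕ) : MeasurableSet (countEvent C k) := by
  have : countEvent C k = ⋂ i, (fun ω : Measure X => ω (C i)) ⁻¹' {(k i : ℝ≥0∞)} := by
    ext ω; simp [countEvent]
  rw [this]
  exact .iInter fun i => Measure.measurable_coe (hC.measurableSet i) (measurableSet_singleton _)

lemma ext_of_countEvent [SigmaFinite ν] {Q Q' : Measure (Measure X)}
    [IsFiniteMeasure Q] {D₀ : Set X} (hD₀ : MeasurableSet D₀) (hνD₀ : ν D₀ ≠ ∞)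
    (hQ : ∀ D, MeasurableSet D → ν D ≠ ∞ → ∀ᵐ ω ∂Q, ω D ∈ Set.range ((↑) : ℕ → ℝ≥0∞))
    (hQ' : ∀ D, MeasurableSet D → ν D ≠ ∞ → ∀ᵐ ω ∂Q', ω D ∈ Set.range ((↑) : ℕ → ℝ≥0∞))
    (h : ∀ (m : ℕ) (C : Fin m → Set X), IsFiniteDisjointFamily ν C →
      (∃ I : Finset (Fin m), D₀ = ⋃ i ∈ I, C i) →
      ∀ k, Q (countEvent C k) = Q' (countEvent C k)) : Q = Q' := by
  refine ext_of_map_finiteDisjointFamily hD₀ hνD₀ fun m C hC hcover => ?_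
  have hcount : Measurable fun (ω : Measure X) i => ω (C i) :=
    measurable_pi_lambda _ fun i => Measure.measurable_coe (hC.measurableSet i)
  set cast : (Fin m → ℕ) → Fin m → ℝ≥0∞ := fun k i => k i
  have hrange {Q : Measure (Measure X)}
      (hQ : ∀ D, MeasurableSet D → ν D ≠ ∞ → ∀ᵐ ω ∂Q, ω D ∈ Set.range ((↑) : ℕ → ℝ≥0∞)) :
      ∀ᵐ y ∂Q.map (fun ω i => ω (C i)), y ∈ Set.range cast := by
    refine (ae_map_iff hcount.aemeasurable (Set.countable_range cast).measurableSet).2 ?_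
    filter_upwards [ae_all_iff.2 fun i => hQ _ (hC.measurableSet i) (hC.measure_ne_top i)]
      with ω hω
    choose k hk using hω
    exact ⟨k, funext hk⟩
  refine ext_of_ae_mem_countable (Set.countable_range cast) (hrange hQ) (hrange hQ') ?_
  rintro _ ⟨k, rfl⟩
  have hpre : (fun (ω : Measure X) i => ω (C i)) ⁻¹' {cast k} = countEvent C k := by
    ext ω; exact funext_iff
  rw [Measure.map_apply hcount (measurableSet_singleton _),
    Measure.map_apply hcount (measurableSet_singleton _), hpre, h m C hC hcover k]

section AddPoint

variable {ι : Type*} {C : ι → Set X} {i : ι} {x : X}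

lemma IsFiniteDisjointFamily.add_dirac_apply [DecidableEq ι]
    (hC : IsFiniteDisjointFamily ν C) (hx : x ∈ C i) (ω : Measure X) (j : ι) :
    (ω + Measure.dirac x) (C j) = ω (C j) + (Pi.single i 1 : ι → ℕ) j := by
  rw [Measure.add_apply, Measure.dirac_apply' _ (hC.measurableSet j)]
  rcases eq_or_ne j i with rfl | hj
  · simp [hx]
  · have : x ∉ C j := fun h => Set.disjoint_left.1 (hC.disjoint hj) h hx
    simp [this, hj]

lemma IsFiniteDisjointFamily.add_dirac_mem_countEvent [DecidableEq ι]
    (hC : IsFiniteDisjointFamily ν C) (hx : x ∈ C i) {ω : Measure X} {k : ι → ℕ} :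
    ω + Measure.dirac x ∈ countEvent C (k + Pi.single i 1) ↔ ω ∈ countEvent C k := by
  refine forall_congr' fun j => ?_
  rw [hC.add_dirac_apply hx, Pi.add_apply, Nat.cast_add,
    ENNReal.add_left_inj (ENNReal.natCast_ne_top _)]

lemma IsFiniteDisjointFamily.add_dirac_notMem_countEvent (hC : IsFiniteDisjointFamily ν C)
    (hx : x ∈ C i) {ω : Measure X} {k : ι → ℕ} (hk : k i = 0) :
    ω + Measure.dirac x ∉ countEvent C k := fun h => by
  classical
  have := h i
  rw [hC.add_dirac_apply hx, hk] at this
  simp at this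

end AddPoint

end RandomMeasure

section PoissonProcess

lemma succ_mul_poissonMeasure_succ (r : ℝ≥0) (k : ℕ) :
    (k + 1 : ℝ≥0∞) * poissonMeasure r {k + 1} = r * poissonMeasure r {k} := by
  rw [poissonMeasure_singleton, poissonMeasure_singleton, ← Nat.cast_succ,
    ← ENNReal.ofReal_natCast, ← ENNReal.ofReal_coe_nnreal, ← ENNReal.ofReal_mul (by positivity),
    ← ENNReal.ofReal_mul (by positivity), Nat.factorial_succ]
  congr 1
  push_cast
  field_simp
  ring

lemma poissonMeasure_zero_ne_zero (r : ℝ≥0) : poissonMeasure r {0} ≠ 0 := by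
  rw [poissonMeasure_singleton, ENNReal.ofReal_ne_zero_iff]
  positivity

lemma exists_eq_add_single {ι : Type*} [DecidableEq ι] {k : ι → ℕ} {i : ι} (hk : k i ≠ 0) :
    ∃ l : ι → ℕ, k = l + Pi.single i 1 := by
  refine ⟨Function.update k i (k i - 1), funext fun j => ?_⟩
  rcases eq_or_ne j i with rfl | hj
  · simp only [Pi.add_apply, Function.update_self, Pi.single_eq_same]
    lia
  · simp [hj]

lemma apply_mul_apply_zero_of_recursion {ι : Type*} [Finite ι] [DecidableEq ι]
    {f g : (ι → ℕ) → ℝ≥0∞} {c : ι → ℝ≥0∞}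
    (hf : ∀ k i, (k i + 1 : ℝ≥0∞) * f (k + Pi.single i 1) = c i * f k)
    (hg : ∀ k i, (k i + 1 : ℝ≥0∞) * g (k + Pi.single i 1) = c i * g k) (k : ι → ℕ) :
    f k * g 0 = f 0 * g k := by
  cases nonempty_fintype ι
  induction hN : ∑ i, k i generalizing k with
  | zero =>
    have : k = 0 := funext fun i => Finset.sum_eq_zero_iff.1 hN i (Finset.mem_univ i)
    rw [this]
  | succ N ih =>
    obtain ⟨i, -, hi⟩ := Finset.exists_ne_zero_of_sum_ne_zero (hN.trans_ne N.succ_ne_zero)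
    obtain ⟨l, rfl⟩ : ∃ l, k = l + Pi.single i 1 := exists_eq_add_single hi
    have hl : ∑ j, l j = N := by simpa [Finset.sum_add_distrib] using hN
    refine (ENNReal.mul_right_inj (a := (l i + 1 : ℝ≥0∞)) (by simp) (by finiteness)).1 ?_
    rw [← mul_assoc, hf, mul_assoc, ih l hl, mul_left_comm (c i), ← hg,
      mul_left_comm (f 0)]

variable {S X : Type*} [MeasurableSpace S] [MeasurableSpace X] {ν : Measure X}
  {ξ : S → Measure X} {P : Measure S}

lemma IsPoissonPointProcess.measurable_apply (hP : IsPoissonPointProcess ν ξ P) {D : Set X}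
    (hD : MeasurableSet D) : Measurable fun s => ξ s D :=
  (Measure.measurable_coe hD).comp hP.measurable

lemma IsPoissonPointProcess.measurable_lintegral (hP : IsPoissonPointProcess ν ξ P)
    {r : X → ℝ≥0∞} (hr : Measurable r) : Measurable fun s => ∫⁻ x, r x ∂ξ s :=
  (Measure.measurable_lintegral hr).comp hP.measurable

lemma IsPoissonPointProcess.measurable_add_dirac (hP : IsPoissonPointProcess ν ξ P) :
    Measurable fun p : S × X => ξ p.1 + Measure.dirac p.2 :=
  (hP.measurable.comp measurable_fst).add (Measure.measurable_dirac.comp measurable_snd)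

lemma IsPoissonPointProcess.ae_apply_mem_range_natCast (hP : IsPoissonPointProcess ν ξ P)
    {D : Set X} (hD : MeasurableSet D) (hνD : ν D ≠ ∞) :
    ∀ᵐ s ∂P, ξ s D ∈ Set.range ((↑) : ℕ → ℝ≥0∞) := by
  refine ae_of_ae_map (hP.measurable_apply hD).aemeasurable ?_
  rw [hP.poisson D hD hνD]
  exact (ae_map_iff Measurable.of_discrete.aemeasurable
    (Set.countable_range _).measurableSet).2 (.of_forall Set.mem_range_self)

lemma IsPoissonPointProcess.measure_countEvent (hP : IsPoissonPointProcess ν ξ P) {m : ℕ}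
    {C : Fin m → Set X} (hC : IsFiniteDisjointFamily ν C) (k : Fin m → ℕ) :
    P (ξ ⁻¹' countEvent C k) = ∏ i, poissonMeasure (ν (C i)).toNNReal {k i} := by
  have hset : ξ ⁻¹' countEvent C k
      = ⋂ i ∈ Finset.univ, (fun s => ξ s (C i)) ⁻¹' {(k i : ℝ≥0∞)} := by
    ext s; simp [countEvent]
  rw [hset, (hP.indep m C hC.measurableSet hC.disjoint).measure_inter_preimage_eq_mul
    Finset.univ fun i _ => measurableSet_singleton _]
  refine Finset.prod_congr rfl fun i _ => ?_
  rw [← Measure.map_apply (hP.measurable_apply (hC.measurableSet i)) (measurableSet_singleton _),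
    hP.poisson _ (hC.measurableSet i) (hC.measure_ne_top i),
    Measure.map_apply Measurable.of_discrete (measurableSet_singleton _)]
  congr 1
  ext j
  simp

lemma IsPoissonPointProcess.succ_mul_measure_countEvent (hP : IsPoissonPointProcess ν ξ P) {m : ℕ}
    {C : Fin m → Set X} (hC : IsFiniteDisjointFamily ν C) (k : Fin m → ℕ) (i : Fin m) :
    (k i + 1 : ℝ≥0∞) * P (ξ ⁻¹' countEvent C (k + Pi.single i 1))
      = ν (C i) * P (ξ ⁻¹' countEvent C k) := by
  rw [hP.measure_countEvent hC, hP.measure_countEvent hC, Fintype.prod_eq_mul_prod_compl i,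
    Fintype.prod_eq_mul_prod_compl i fun j => poissonMeasure (ν (C j)).toNNReal {k j},
    ← mul_assoc, ← mul_assoc]
  congr 1
  · rw [Pi.add_apply, Pi.single_eq_same, succ_mul_poissonMeasure_succ,
      ENNReal.coe_toNNReal (hC.measure_ne_top i)]
  · refine Finset.prod_congr rfl fun j hj => ?_
    have hji : j ≠ i := by simpa using hj
    simp [hji]

lemma IsPoissonPointProcess.lintegral_add_dirac_countEvent (hP : IsPoissonPointProcess ν ξ P)
    {m : ℕ} {C : Fin m → Set X} (hC : IsFiniteDisjointFamily ν C) (k : Fin m → ℕ) (i : Fin m) :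
    ∫⁻ x in C i, P {s | ξ s + Measure.dirac x ∈ countEvent C k} ∂ν
      = k i * P (ξ ⁻¹' countEvent C k) := by
  rcases eq_or_ne (k i) 0 with hk | hk
  · have hempty : ∀ x ∈ C i, P {s | ξ s + Measure.dirac x ∈ countEvent C k} = 0 := fun x hx => by
      simp only [hC.add_dirac_notMem_countEvent hx hk, Set.ofPred_false, measure_empty]
    rw [setLIntegral_congr_fun (hC.measurableSet i) hempty, hk]
    simp
  · obtain ⟨l, rfl⟩ : ∃ l, k = l + Pi.single i 1 := exists_eq_add_single hk
    have hconst : ∀ x ∈ C i, P {s | ξ s + Measure.dirac x ∈ countEvent C (l + Pi.single i 1)}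
        = P (ξ ⁻¹' countEvent C l) := fun x hx => by
      simp only [hC.add_dirac_mem_countEvent hx]
      rfl
    rw [setLIntegral_congr_fun (hC.measurableSet i) hconst, setLIntegral_const, mul_comm,
      ← hP.succ_mul_measure_countEvent hC]
    simp

lemma IsPoissonPointProcess.lintegral_biUnion_countEvent (hP : IsPoissonPointProcess ν ξ P)
    {m : ℕ} {C : Fin m → Set X} (hC : IsFiniteDisjointFamily ν C) (k : Fin m → ℕ)
    (I : Finset (Fin m)) :
    ∫⁻ s in ξ ⁻¹' countEvent C k, ξ s (⋃ i ∈ I, C i) ∂P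
      = ∑ i ∈ I, k i * P (ξ ⁻¹' countEvent C k) := by
  have hcount : ∀ s ∈ ξ ⁻¹' countEvent C k, ξ s (⋃ i ∈ I, C i) = ∑ i ∈ I, (k i : ℝ≥0∞) := by
    intro s hs
    rw [measure_biUnion_finset (fun i _ j _ hij => hC.disjoint hij) fun i _ =>
      hC.measurableSet i]
    exact Finset.sum_congr rfl fun i _ => hs i
  rw [setLIntegral_congr_fun (hP.measurable (hC.measurableSet_countEvent k)) hcount,
    setLIntegral_const, Finset.sum_mul]

lemma IsPoissonPointProcess.map_add_dirac [SigmaFinite ν] (hP : IsPoissonPointProcess ν ξ P)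
    {D : Set X} (hD : MeasurableSet D) (hνD : ν D ≠ ∞) :
    (P.prod (ν.restrict D)).map (fun p => ξ p.1 + Measure.dirac p.2)
      = (P.withDensity fun s => ξ s D).map ξ := by
  have := hP.isProbabilityMeasure
  have : IsFiniteMeasure (ν.restrict D) := isFiniteMeasure_restrict.2 hνD
  refine ext_of_countEvent hD hνD (fun D' hD' hνD' => ?_) (fun D' hD' hνD' => ?_) ?_
  · have hrange : MeasurableSet {ω : Measure X | ω D' ∈ Set.range ((↑) : ℕ → ℝ≥0∞)} :=
      Measure.measurable_coe hD' (Set.countable_range _).measurableSet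
    rw [ae_map_iff hP.measurable_add_dirac.aemeasurable hrange]
    filter_upwards [Measure.quasiMeasurePreserving_fst.ae
      (hP.ae_apply_mem_range_natCast hD' hνD')] with p ⟨n, hn⟩
    rw [Measure.add_apply, ← hn, Measure.dirac_apply' _ hD']
    by_cases hp : p.2 ∈ D'
    · exact ⟨n + 1, by simp [hp]⟩
    · exact ⟨n, by simp [hp]⟩
  · refine (ae_map_iff hP.measurable.aemeasurable ?_).2 ?_
    · exact Measure.measurable_coe hD' (Set.countable_range _).measurableSet
    · exact (withDensity_absolutelyContinuous P _).ae_le (hP.ae_apply_mem_range_natCast hD' hνD')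
  · rintro m C hC ⟨I, rfl⟩ k
    have hm := hC.measurableSet_countEvent k
    rw [Measure.map_apply hP.measurable_add_dirac hm,
      Measure.prod_apply_symm (hP.measurable_add_dirac hm), Measure.map_apply hP.measurable hm,
      withDensity_apply _ (hP.measurable hm), hP.lintegral_biUnion_countEvent hC,
      lintegral_biUnion_finset (fun i _ j _ hij => hC.disjoint hij) fun i _ => hC.measurableSet i]
    exact Finset.sum_congr rfl fun i _ => hP.lintegral_add_dirac_countEvent hC k i

lemma IsPoissonPointProcess.mecke_set [SigmaFinite ν] (hP : IsPoissonPointProcess ν ξ P)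
    {φ : Measure X → ℝ≥0∞} (hφ : Measurable φ) {D : Set X} (hD : MeasurableSet D)
    (hνD : ν D ≠ ∞) :
    ∫⁻ s, φ (ξ s) * ξ s D ∂P = ∫⁻ x in D, ∫⁻ s, φ (ξ s + Measure.dirac x) ∂P ∂ν := by
  have := hP.isProbabilityMeasure
  have hφξ : Measurable fun s => φ (ξ s) := hφ.comp hP.measurable
  calc ∫⁻ s, φ (ξ s) * ξ s D ∂P
      = ∫⁻ s, φ (ξ s) ∂P.withDensity fun s => ξ s D := by
        rw [lintegral_withDensity_eq_lintegral_mul _ (hP.measurable_apply hD) hφξ]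
        exact lintegral_congr fun s => mul_comm _ _
    _ = ∫⁻ p, φ (ξ p.1 + Measure.dirac p.2) ∂P.prod (ν.restrict D) := by
        rw [← lintegral_map hφ hP.measurable, ← hP.map_add_dirac hD hνD,
          lintegral_map hφ hP.measurable_add_dirac]
    _ = _ := lintegral_prod_symm _ (hφ.comp hP.measurable_add_dirac).aemeasurable

lemma IsPoissonPointProcess.mecke [SigmaFinite ν] (hP : IsPoissonPointProcess ν ξ P)
    {φ : Measure X → ℝ≥0∞} (hφ : Measurable φ) {r : X → ℝ≥0∞} (hr : Measurable r) :
    ∫⁻ s, φ (ξ s) * ∫⁻ x, r x ∂ξ s ∂P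
      = ∫⁻ x, r x * ∫⁻ s, φ (ξ s + Measure.dirac x) ∂P ∂ν := by
  have := hP.isProbabilityMeasure
  have hφξ : Measurable fun s => φ (ξ s) := hφ.comp hP.measurable
  have hψ : Measurable fun x => ∫⁻ s, φ (ξ s + Measure.dirac x) ∂P :=
    (hφ.comp hP.measurable_add_dirac).lintegral_prod_left'
  have hbind : (P.withDensity fun s => φ (ξ s)).bind ξ
      = ν.withDensity fun x => ∫⁻ s, φ (ξ s + Measure.dirac x) ∂P :=
    ext_of_measure_ne_top ν fun D hD hνD => by
      rw [Measure.bind_apply hD hP.measurable.aemeasurable, withDensity_apply _ hD,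
        ← hP.mecke_set hφ hD hνD,
        lintegral_withDensity_eq_lintegral_mul _ hφξ (hP.measurable_apply hD)]
      rfl
  calc ∫⁻ s, φ (ξ s) * ∫⁻ x, r x ∂ξ s ∂P
      = ∫⁻ x, r x ∂(P.withDensity fun s => φ (ξ s)).bind ξ := by
        rw [Measure.lintegral_bind hP.measurable.aemeasurable hr.aemeasurable,
          lintegral_withDensity_eq_lintegral_mul _ hφξ (hP.measurable_lintegral hr)]
        rfl
    _ = ∫⁻ x, r x * ∫⁻ s, φ (ξ s + Measure.dirac x) ∂P ∂ν := by
        rw [hbind, lintegral_withDensity_eq_lintegral_mul _ hψ hr]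
        exact lintegral_congr fun x => mul_comm _ _

lemma IsPoissonPointProcess.tsum_measure_inter_countEvent (hP : IsPoissonPointProcess ν ξ P)
    {m : ℕ} {C : Fin m → Set X} (hC : IsFiniteDisjointFamily ν C) {A : Set S}
    (hA : MeasurableSet A) : ∑' k, P (ξ ⁻¹' countEvent C k ∩ A) = P A := by
  have hmeas (k : Fin m → ℕ) : MeasurableSet (ξ ⁻¹' countEvent C k) :=
    hP.measurable (hC.measurableSet_countEvent k)
  have hdisj : Pairwise (Function.onFun Disjoint fun k => ξ ⁻¹' countEvent C k ∩ A) :=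
    fun k l hkl => Set.disjoint_left.2 fun s hk hl => hkl <| funext fun i => by
      exact_mod_cast (hk.1 i).symm.trans (hl.1 i)
  rw [← measure_iUnion hdisj fun k => (hmeas k).inter hA, ← Set.iUnion_inter, Set.inter_comm]
  refine measure_inter_conull (ae_iff.1 (?_ : ∀ᵐ s ∂P, s ∈ ⋃ k, ξ ⁻¹' countEvent C k))
  filter_upwards [ae_all_iff.2 fun i => hP.ae_apply_mem_range_natCast (hC.measurableSet i)
    (hC.measure_ne_top i)] with s hs
  choose k hk using hs
  exact Set.mem_iUnion.2 ⟨k, fun i => (hk i).symm⟩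

lemma IsPoissonPointProcess.succ_mul_measure_countEvent_inter [SigmaFinite ν]
    (hP : IsPoissonPointProcess ν ξ P) {E : Set (Measure X)} (hE : MeasurableSet E)
    (hinv : ∀ᵐ x ∂ν, ∀ᵐ s ∂P, ξ s + Measure.dirac x ∈ E ↔ ξ s ∈ E) {m : ℕ}
    {C : Fin m → Set X} (hC : IsFiniteDisjointFamily ν C) (k : Fin m → ℕ) (i : Fin m) :
    (k i + 1 : ℝ≥0∞) * P (ξ ⁻¹' countEvent C (k + Pi.single i 1) ∩ ξ ⁻¹' E)
      = ν (C i) * P (ξ ⁻¹' countEvent C k ∩ ξ ⁻¹' E) := by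
  set F := countEvent C (k + Pi.single i 1) ∩ E
  have hF : MeasurableSet F := (hC.measurableSet_countEvent _).inter hE
  have hmecke := hP.mecke_set (φ := F.indicator 1) (measurable_one.indicator hF)
    (hC.measurableSet i) (hC.measure_ne_top i)
  have hleft : ∫⁻ s, F.indicator 1 (ξ s) * ξ s (C i) ∂P = (k i + 1) * P (ξ ⁻¹' F) := by
    rw [← lintegral_indicator_const (hP.measurable hF)]
    refine lintegral_congr fun s => ?_
    by_cases hs : ξ s ∈ F
    · simpa [hs] using hs.1 i
    · simp [hs]
  have hright : ∀ᵐ x ∂ν, x ∈ C i → ∫⁻ s, F.indicator 1 (ξ s + Measure.dirac x) ∂P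
      = P (ξ ⁻¹' (countEvent C k ∩ E)) := by
    filter_upwards [hinv] with x hx hxC
    rw [← lintegral_indicator_one (hP.measurable ((hC.measurableSet_countEvent k).inter hE))]
    refine lintegral_congr_ae (hx.mono fun s hs => ?_)
    have hiff : ξ s + Measure.dirac x ∈ F ↔ s ∈ ξ ⁻¹' (countEvent C k ∩ E) :=
      and_congr (hC.add_dirac_mem_countEvent hxC) hs
    beta_reduce
    by_cases hs' : s ∈ ξ ⁻¹' (countEvent C k ∩ E)
    · rw [Set.indicator_of_mem (hiff.2 hs'), Set.indicator_of_mem hs']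
      rfl
    · rw [Set.indicator_of_notMem (mt hiff.1 hs'), Set.indicator_of_notMem hs']
  rw [hleft, setLIntegral_congr_fun_ae (hC.measurableSet i) hright, setLIntegral_const,
    mul_comm _ (ν (C i))] at hmecke
  exact hmecke

lemma IsPoissonPointProcess.restrict_eq_smul_of_add_dirac [SigmaFinite ν]
    (hP : IsPoissonPointProcess ν ξ P) {E : Set (Measure X)} (hE : MeasurableSet E)
    (hinv : ∀ᵐ x ∂ν, ∀ᵐ s ∂P, ξ s + Measure.dirac x ∈ E ↔ ξ s ∈ E) :
    (P.map ξ).restrict E = P (ξ ⁻¹' E) • P.map ξ := by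
  have := hP.isProbabilityMeasure
  have hint (D : Set X) (hD : MeasurableSet D) (hνD : ν D ≠ ∞) :
      ∀ᵐ ω ∂P.map ξ, ω D ∈ Set.range ((↑) : ℕ → ℝ≥0∞) :=
    (ae_map_iff hP.measurable.aemeasurable (Measure.measurable_coe hD
      (Set.countable_range _).measurableSet)).2 (hP.ae_apply_mem_range_natCast hD hνD)
  refine ext_of_countEvent MeasurableSet.empty (ν := ν) (by simp)
    (fun D hD hνD => ae_restrict_of_ae (hint D hD hνD))
    (fun D hD hνD => Measure.ae_smul_measure (hint D hD hνD) _) fun m C hC _ k => ?_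
  have hcount := apply_mul_apply_zero_of_recursion
    (f := fun k => P (ξ ⁻¹' countEvent C k ∩ ξ ⁻¹' E)) (g := fun k => P (ξ ⁻¹' countEvent C k))
    (hP.succ_mul_measure_countEvent_inter hE hinv hC) (hP.succ_mul_measure_countEvent hC)
  have hzero_ne : P (ξ ⁻¹' countEvent C 0) ≠ 0 := by
    rw [hP.measure_countEvent hC]
    exact Finset.prod_ne_zero_iff.2 fun i _ => poissonMeasure_zero_ne_zero _
  have hzero : P (ξ ⁻¹' E) * P (ξ ⁻¹' countEvent C 0)
      = P (ξ ⁻¹' countEvent C 0 ∩ ξ ⁻¹' E) := by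
    have hone := hP.tsum_measure_inter_countEvent hC MeasurableSet.univ
    simp only [Set.inter_univ, measure_univ] at hone
    rw [← hP.tsum_measure_inter_countEvent hC (hP.measurable hE), ← ENNReal.tsum_mul_right,
      tsum_congr hcount, ENNReal.tsum_mul_left, hone, mul_one]
  have hm := hC.measurableSet_countEvent k
  rw [Measure.restrict_apply hm, Measure.smul_apply, smul_eq_mul,
    Measure.map_apply hP.measurable hm, Measure.map_apply hP.measurable (hm.inter hE)]
  refine (ENNReal.mul_left_inj hzero_ne (measure_ne_top _ _)).1 ?_
  rw [Set.preimage_inter, hcount, ← hzero, mul_right_comm]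

lemma IsPoissonPointProcess.zero_or_one_of_add_dirac [SigmaFinite ν]
    (hP : IsPoissonPointProcess ν ξ P) {E : Set (Measure X)} (hE : MeasurableSet E)
    (hinv : ∀ᵐ x ∂ν, ∀ᵐ s ∂P, ξ s + Measure.dirac x ∈ E ↔ ξ s ∈ E) :
    P (ξ ⁻¹' E) = 0 ∨ P (ξ ⁻¹' E) = 1 := by
  have := hP.isProbabilityMeasure
  have hsq := congrArg (· E) (hP.restrict_eq_smul_of_add_dirac hE hinv)
  simp only [Measure.restrict_apply_self, Measure.smul_apply, smul_eq_mul,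
    Measure.map_apply hP.measurable hE] at hsq
  exact or_iff_not_imp_left.2 fun h0 =>
    (ENNReal.mul_right_inj h0 (measure_ne_top P _)).1 (by rw [mul_one, ← hsq])

end PoissonProcess

section MeckeEstimate

variable {S X : Type*} [MeasurableSpace S] [MeasurableSpace X] {ν : Measure X}
  {ξ : S → Measure X} {P : Measure S}

lemma lintegral_sub_one_sq_le {Ω : Type*} [MeasurableSpace Ω] {P : Measure Ω}
    [IsProbabilityMeasure P] {Y : Ω → ℝ≥0∞} (hY : Measurable Y) {h : ℝ≥0∞}
    (hY1 : ∫⁻ s, Y s ∂P = 1) (hY2 : ∫⁻ s, Y s ^ 2 ∂P ≤ 1 + h) :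
    ∫⁻ s, (Y s - 1) ^ 2 ∂P ≤ h := by
  have hpt : ∀ᵐ s ∂P, (Y s - 1) ^ 2 + 2 * Y s ≤ Y s ^ 2 + 1 := by
    filter_upwards [ae_lt_top hY (hY1.trans_ne ENNReal.one_ne_top)] with s hs
    lift Y s to ℝ≥0 using hs.ne with y
    norm_cast
    rw [← NNReal.coe_le_coe]
    rcases le_total y 1 with hy | hy
    · rw [tsub_eq_zero_of_le hy]
      push_cast
      nlinarith [sq_nonneg ((y : ℝ) - 1)]
    · push_cast [NNReal.coe_sub hy]
      nlinarith
  have hsum := lintegral_mono_ae hpt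
  rw [lintegral_add_right _ (hY.const_mul 2), lintegral_const_mul _ hY, hY1,
    lintegral_add_right _ measurable_const, lintegral_const, measure_univ] at hsum
  refine (ENNReal.add_le_add_iff_right (a := 2) (by finiteness)).1 ?_
  calc ∫⁻ s, (Y s - 1) ^ 2 ∂P + 2 ≤ ∫⁻ s, Y s ^ 2 ∂P + 1 := by simpa using hsum
    _ ≤ 1 + h + 1 := by gcongr
    _ = h + 2 := by ring

lemma lintegral_mul_le_add_rpow {Ω : Type*} [MeasurableSpace Ω] {P : Measure Ω}
    [IsProbabilityMeasure P] {φ Y : Ω → ℝ≥0∞} (hφ : Measurable φ) (hφ1 : ∀ s, φ s ≤ 1)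
    (hY : Measurable Y) {h : ℝ≥0∞} (hY1 : ∫⁻ s, Y s ∂P = 1) (hY2 : ∫⁻ s, Y s ^ 2 ∂P ≤ 1 + h) :
    ∫⁻ s, φ s * Y s ∂P ≤ ∫⁻ s, φ s ∂P + h ^ (1 / 2 : ℝ) := by
  have hpt (s : Ω) : φ s * Y s ≤ φ s + (Y s - 1) :=
    calc φ s * Y s ≤ φ s * (1 + (Y s - 1)) := by gcongr; exact le_add_tsub
      _ ≤ φ s + (Y s - 1) := by
        rw [mul_add, mul_one]
        gcongr
        exact mul_le_of_le_one_left' (hφ1 s)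
  calc ∫⁻ s, φ s * Y s ∂P ≤ ∫⁻ s, φ s + (Y s - 1) ∂P := lintegral_mono hpt
    _ = ∫⁻ s, φ s ∂P + ∫⁻ s, (Y s - 1) * 1 ∂P := by rw [lintegral_add_left hφ]; simp
    _ ≤ ∫⁻ s, φ s ∂P + (∫⁻ s, (Y s - 1) ^ (2 : ℝ) ∂P) ^ (1 / 2 : ℝ) *
        (∫⁻ _, 1 ^ (2 : ℝ) ∂P) ^ (1 / 2 : ℝ) := by
      gcongr
      exact ENNReal.lintegral_mul_le_Lp_mul_Lq P Real.HolderConjugate.two_two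
        (hY.sub_const 1).aemeasurable aemeasurable_const
    _ ≤ ∫⁻ s, φ s ∂P + h ^ (1 / 2 : ℝ) := by
      simp only [ENNReal.rpow_two, one_pow, ENNReal.one_rpow, lintegral_const, measure_univ,
        mul_one]
      gcongr
      exact lintegral_sub_one_sq_le hY hY1 hY2

lemma rnDeriv_le_of_le_withDensity [SigmaFinite ν] {μ : Measure X} [SigmaFinite μ]
    {H : X → ℝ≥0∞} (hμ : μ ≤ ν.withDensity H) : μ.rnDeriv ν ≤ᵐ[ν] H := by
  have hac : μ ≪ ν := (Measure.absolutelyContinuous_of_le hμ).trans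
    (withDensity_absolutelyContinuous ν H)
  refine ae_le_of_forall_setLIntegral_le_of_sigmaFinite (Measure.measurable_rnDeriv μ ν)
    fun s hs _ => ?_
  rw [← withDensity_apply _ hs, ← withDensity_apply _ hs, Measure.withDensity_rnDeriv_eq μ ν hac]
  exact hμ s

lemma IsPoissonPointProcess.mecke_rnDeriv [SigmaFinite ν] (hP : IsPoissonPointProcess ν ξ P)
    {μ : Measure X} [SigmaFinite μ] (hμ : μ ≪ ν) {φ : Measure X → ℝ≥0∞} (hφ : Measurable φ) :
    ∫⁻ s, φ (ξ s) * ∫⁻ x, μ.rnDeriv ν x ∂ξ s ∂P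
      = ∫⁻ x, ∫⁻ s, φ (ξ s + Measure.dirac x) ∂P ∂μ := by
  have := hP.isProbabilityMeasure
  rw [hP.mecke hφ (Measure.measurable_rnDeriv μ ν)]
  exact lintegral_rnDeriv_mul hμ (hφ.comp hP.measurable_add_dirac).lintegral_prod_left'.aemeasurable

lemma IsPoissonPointProcess.lintegral_add_dirac_le [SigmaFinite ν]
    (hP : IsPoissonPointProcess ν ξ P) {μ : Measure X} [IsProbabilityMeasure μ]
    {H : X → ℝ≥0∞} (hμ : μ ≤ ν.withDensity H) {φ : Measure X → ℝ≥0∞}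
    (hφ : Measurable φ) (hφ1 : ∀ ω, φ ω ≤ 1) :
    ∫⁻ x, ∫⁻ s, φ (ξ s + Measure.dirac x) ∂P ∂μ
      ≤ ∫⁻ s, φ (ξ s) ∂P + (∫⁻ x, H x ∂μ) ^ (1 / 2 : ℝ) := by
  have := hP.isProbabilityMeasure
  have hac : μ ≪ ν := (Measure.absolutelyContinuous_of_le hμ).trans
    (withDensity_absolutelyContinuous ν H)
  set r := μ.rnDeriv ν
  have hr : Measurable r := Measure.measurable_rnDeriv μ ν
  have hY : Measurable fun s => ∫⁻ x, r x ∂ξ s := hP.measurable_lintegral hr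
  have hY1 : ∫⁻ s, ∫⁻ x, r x ∂ξ s ∂P = 1 := by
    simpa using hP.mecke_rnDeriv hac (φ := fun _ => 1) measurable_const
  have hY2 : ∫⁻ s, (∫⁻ x, r x ∂ξ s) ^ 2 ∂P ≤ 1 + ∫⁻ x, H x ∂μ := by
    have hmecke := hP.mecke_rnDeriv hac (Measure.measurable_lintegral hr)
    simp only [lintegral_add_measure, lintegral_dirac' _ hr, lintegral_add_left hY, hY1,
      lintegral_const, measure_univ, mul_one] at hmecke
    rw [lintegral_add_left measurable_const, lintegral_const, measure_univ, mul_one] at hmecke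
    simp_rw [sq]
    rw [hmecke]
    gcongr 1 + ?_
    exact lintegral_mono_ae (hac.ae_le (rnDeriv_le_of_le_withDensity hμ))
  rw [← hP.mecke_rnDeriv hac hφ]
  exact lintegral_mul_le_add_rpow (hφ.comp hP.measurable) (fun s => hφ1 _) hY hY1 hY2

lemma IsPoissonPointProcess.lintegral_add_dirac_add_dirac_le [SigmaFinite ν]
    (hP : IsPoissonPointProcess ν ξ P) {μ : Measure X} [IsProbabilityMeasure μ]
    {H : X → ℝ≥0∞} (hμ : μ ≤ ν.withDensity H) {φ : Measure X → ℝ≥0∞}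
    (hφ : Measurable φ) (hφ1 : ∀ ω, φ ω ≤ 1) :
    ∫⁻ s, ∫⁻ x, ∫⁻ y, φ (ξ s + Measure.dirac x + Measure.dirac y) ∂μ ∂μ ∂P
      ≤ ∫⁻ s, φ (ξ s) ∂P + (∫⁻ x, H x ∂μ) ^ (1 / 2 : ℝ) + (∫⁻ x, H x ∂μ) ^ (1 / 2 : ℝ) := by
  have := hP.isProbabilityMeasure
  have hswap {χ : Measure X → ℝ≥0∞} (hχ : Measurable χ) :
      ∫⁻ s, ∫⁻ x, χ (ξ s + Measure.dirac x) ∂μ ∂P = ∫⁻ x, ∫⁻ s, χ (ξ s + Measure.dirac x) ∂P ∂μ :=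
    lintegral_lintegral_swap (f := fun s x => χ (ξ s + Measure.dirac x))
      (hχ.comp hP.measurable_add_dirac).aemeasurable
  set ψ : Measure X → ℝ≥0∞ := fun η => ∫⁻ y, φ (η + Measure.dirac y) ∂μ
  have hψ : Measurable ψ := Measurable.lintegral_prod_right'
    (f := fun p : Measure X × X => φ (p.1 + Measure.dirac p.2))
    (hφ.comp (measurable_fst.add (Measure.measurable_dirac.comp measurable_snd)))
  have hψ1 (η : Measure X) : ψ η ≤ 1 := (lintegral_mono fun y => hφ1 _).trans (by simp)
  calc ∫⁻ s, ∫⁻ x, ψ (ξ s + Measure.dirac x) ∂μ ∂P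
      = ∫⁻ x, ∫⁻ s, ψ (ξ s + Measure.dirac x) ∂P ∂μ := hswap hψ
    _ ≤ ∫⁻ s, ψ (ξ s) ∂P + (∫⁻ x, H x ∂μ) ^ (1 / 2 : ℝ) := hP.lintegral_add_dirac_le hμ hψ hψ1
    _ = ∫⁻ y, ∫⁻ s, φ (ξ s + Measure.dirac y) ∂P ∂μ + (∫⁻ x, H x ∂μ) ^ (1 / 2 : ℝ) := by
        rw [← hswap hφ]
    _ ≤ _ := by
        gcongr
        exact hP.lintegral_add_dirac_le hμ hφ hφ1

end MeckeEstimate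

/-! ### Markov chains and Green functions -/

section Sequences

variable {V : Type*}

/-- The sequence that follows `b` before time `n` and runs through `w` from time `n` on. -/
def splice (n : ℕ) (b w : ℕ → V) : ℕ → V := fun i => if i < n then b i else w (i - n)

/-- The sequence `w` seen from time `n` on. -/
def shiftPath (n : ℕ) (w : ℕ → V) : ℕ → V := fun i => w (n + i)

/-- The sequence that starts with `x` and continues with `w`. -/
def consPath (x : V) (w : ℕ → V) : ℕ → V := fun n => Nat.casesOn n x w

/-- The sequences that visit `y` for the last time at time `m`. -/
def lastVisit (y : V) (m : ℕ) : Set (ℕ → V) := {w | w m = y ∧ shiftPath m w ∈ noReturn {y}}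

@[simp] lemma splice_add (n i : ℕ) (b w : ℕ → V) : splice n b w (n + i) = w i := by
  simp [splice]

@[simp] lemma splice_self (n : ℕ) (b w : ℕ → V) : splice n b w n = w 0 :=
  splice_add n 0 b w

@[simp] lemma shiftPath_splice (n : ℕ) (b w : ℕ → V) : shiftPath n (splice n b w) = w :=
  funext fun i => splice_add n i b w

lemma splice_one (b w : ℕ → V) : splice 1 b w = consPath (b 0) w := by
  funext i
  cases i <;> simp [splice, consPath]

lemma splice_mem_cylinder_iff {n k : ℕ} {v b w : ℕ → V} (hw : w 0 = b n) :
    splice n b w ∈ PiNat.cylinder v (n + k + 1) ↔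
      b ∈ PiNat.cylinder v (n + 1) ∧ w ∈ PiNat.cylinder (shiftPath n v) (k + 1) := by
  simp only [PiNat.mem_cylinder_iff]
  refine ⟨fun h => ⟨fun i hi => ?_, fun i hi => ?_⟩, fun ⟨hb, hw'⟩ i hi => ?_⟩
  · rcases Nat.lt_succ_iff_lt_or_eq.1 hi with hi | rfl
    · simpa [splice, hi] using h i (by omega)
    · simpa [hw] using h i (by omega)
  · simpa [shiftPath] using h (n + i) (by omega)
  · by_cases hin : i < n
    · simpa [splice, hin] using hb i (by omega)
    · obtain ⟨j, rfl⟩ := Nat.exists_eq_add_of_le (not_lt.1 hin)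
      simpa [shiftPath] using hw' j (by omega)

lemma cylinder_succ_eq_preimage_frestrictLe (v : ℕ → V) (n : ℕ) :
    PiNat.cylinder v (n + 1) = Preorder.frestrictLe (π := fun _ => V) n ⁻¹'
      {Preorder.frestrictLe (π := fun _ => V) n v} := by
  ext w
  simp [PiNat.mem_cylinder_iff, funext_iff]

lemma mem_lastVisit {y : V} {m : ℕ} {w : ℕ → V} :
    w ∈ lastVisit y m ↔ w m = y ∧ ∀ n, m < n → w n ≠ y := by
  simp only [lastVisit, noReturn, shiftPath, Set.mem_ofPred_eq, Finset.mem_singleton]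
  refine and_congr_right fun _ => ⟨fun h n hn => ?_, fun h n hn => h _ (by omega)⟩
  have := h (n - m) (by omega)
  rwa [Nat.add_sub_cancel' hn.le] at this

lemma pairwise_disjoint_lastVisit (y : V) :
    Pairwise (Function.onFun Disjoint (lastVisit y)) := by
  intro m n hmn
  refine Set.disjoint_left.2 fun w hm hn => ?_
  rw [mem_lastVisit] at hm hn
  rcases lt_or_gt_of_ne hmn with h | h
  · exact hm.2 n h hn.1
  · exact hn.2 m h hm.1

lemma exists_mem_lastVisit {y : V} {w : ℕ → V} (h0 : ∃ n, w n = y)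
    (hf : {n | w n = y}.Finite) : ∃ m, w ∈ lastVisit y m := by
  obtain ⟨m, hm, hmax⟩ := Set.exists_max_image _ id hf h0
  exact ⟨m, mem_lastVisit.2 ⟨hm, fun n hn h => absurd (hmax n h) (by simpa using hn)⟩⟩

variable [MeasurableSpace V]

@[fun_prop]
lemma measurable_splice (n : ℕ) :
    Measurable fun p : (ℕ → V) × (ℕ → V) => splice n p.1 p.2 := by
  refine measurable_pi_iff.2 fun i => ?_
  unfold splice
  split_ifs <;> fun_prop

@[fun_prop]
lemma measurable_shiftPath (n : ℕ) : Measurable (shiftPath (V := V) n) := by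
  unfold shiftPath
  fun_prop

@[fun_prop]
lemma measurable_consPath (x : V) : Measurable (consPath x) := by
  refine measurable_pi_iff.2 fun n => ?_
  cases n with
  | zero => exact measurable_const
  | succ n => exact measurable_pi_apply n

section Discrete

variable [DiscreteMeasurableSpace V]

lemma measurableSet_eval_eq {ι : Type*} (n : ι) (y : V) :
    MeasurableSet {w : ι → V | w n = y} :=
  measurable_pi_apply (X := fun _ => V) n (measurableSet_singleton y)

lemma measurableSet_cylinder (v : ℕ → V) (n : ℕ) : MeasurableSet (PiNat.cylinder v n) := by
  rw [PiNat.cylinder_eq_pi]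
  exact MeasurableSet.pi (Finset.countable_toSet _) fun i _ => measurableSet_singleton _

lemma measurableSet_noReturn (K : Finset V) : MeasurableSet (noReturn K) := by
  have : noReturn K = ⋂ n ∈ Set.Ici 1, (fun w : ℕ → V => w n) ⁻¹' (K : Set V)ᶜ := by
    ext w
    simp [noReturn]
  rw [this]
  exact MeasurableSet.biInter (Set.to_countable _)
    fun n _ => measurable_pi_apply n MeasurableSet.of_discrete

lemma measurableSet_lastVisit (y : V) (m : ℕ) : MeasurableSet (lastVisit y m) :=
  (measurableSet_eval_eq m y).inter (measurable_shiftPath m (measurableSet_noReturn {y}))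

lemma ext_of_cylinder [Countable V] {μ ν : Measure (ℕ → V)} [IsFiniteMeasure μ] (N : ℕ)
    (h : ∀ v, ∀ n ≥ N, μ (PiNat.cylinder v (n + 1)) = ν (PiNat.cylinder v (n + 1))) :
    μ = ν := by
  have hmap : ∀ n ≥ N, μ.map (Preorder.frestrictLe n) = ν.map (Preorder.frestrictLe n) := by
    intro n hn
    refine Measure.ext_of_singleton fun u => ?_
    obtain ⟨v, rfl⟩ : ∃ v : ℕ → V, Preorder.frestrictLe n v = u :=
      ⟨fun i => u ⟨min i n, by simp⟩, funext fun i => by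
        have := Finset.mem_Iic.1 i.2
        simp [this]⟩
    simpa only [Measure.map_apply (Preorder.measurable_frestrictLe n)
      (measurableSet_singleton _), ← cylinder_succ_eq_preimage_frestrictLe] using h v n hn
  have hlim : IsProjectiveLimit ν fun I => μ.map I.restrict := by
    intro I
    have hI : I ⊆ Finset.Iic (max N (I.sup id)) := fun i hi =>
      Finset.mem_Iic.2 (le_max_of_le_right (Finset.le_sup (f := id) hi))
    have hrestrict (ρ : Measure (ℕ → V)) : ρ.map I.restrict =
        (ρ.map (Preorder.frestrictLe (max N (I.sup id)))).map
          (Finset.restrict₂ (π := fun _ => V) hI) := by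
      rw [Measure.map_map (Finset.measurable_restrict₂ _) (Preorder.measurable_frestrictLe _)]
      rfl
    rw [hrestrict ν, ← hmap _ (le_max_left _ _), ← hrestrict μ]
  exact IsProjectiveLimit.unique (fun _ => rfl) hlim

end Discrete

end Sequences

section MarkovChain

variable {V : Type*} [MeasurableSpace V] (κ : Kernel V V) [IsMarkovKernel κ]

/-- The kernel that sends `x` to the law, on sequences, of the time-homogeneous Markov chain with
transition kernel `κ` started at `x`. -/
def pathKernel : Kernel V (ℕ → V) :=
  (Kernel.traj (X := fun _ => V)
    (fun n => κ.comap (fun h : (i : Finset.Iic n) → V => h ⟨n, Finset.mem_Iic.2 le_rfl⟩)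
      (measurable_pi_apply _)) 0).comap (fun x _ => x) (by fun_prop)

instance : IsMarkovKernel (pathKernel κ) := by
  unfold pathKernel
  infer_instance

/-- The `n`-step transition probability from `x` to `y`. -/
def transProb (n : ℕ) (x y : V) : ℝ≥0∞ := pathKernel κ x {w | w n = y}

/-- The Green function, i.e. the expected number of visits to `y` of the chain started at `x`; it
may be infinite. -/
def green (x y : V) : ℝ≥0∞ := ∑' n, transProb κ n x y

variable [DiscreteMeasurableSpace V]

lemma ae_pathKernel_zero (x : V) : ∀ᵐ w ∂pathKernel κ x, w 0 = x := by
  have h := Kernel.traj_map_frestrictLe_apply (X := fun _ => V)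
    (κ := fun n => κ.comap
      (fun h : (i : Finset.Iic n) → V => h ⟨n, Finset.mem_Iic.2 le_rfl⟩) (measurable_pi_apply _))
    0 0 (fun _ => x)
  rw [Kernel.partialTraj_self, Kernel.id_apply] at h
  have hm : MeasurableSet {u : (i : Finset.Iic 0) → V | u ⟨0, by simp⟩ = x} :=
    measurableSet_eval_eq _ x
  have h0 : ∀ᵐ u ∂(pathKernel κ x).map (Preorder.frestrictLe (π := fun _ => V) 0),
      u ⟨0, by simp⟩ = x := by
    rw [pathKernel, Kernel.comap_apply, h]
    exact (ae_dirac_iff hm).2 rfl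
  exact (ae_map_iff (Preorder.measurable_frestrictLe 0).aemeasurable hm).1 h0

lemma transProb_one (x y : V) : transProb κ 1 x y = κ x {y} := by
  have h := Kernel.map_traj_succ_self (X := fun _ => V) (a := 0)
    (κ := fun n => κ.comap
      (fun h : (i : Finset.Iic n) → V => h ⟨n, Finset.mem_Iic.2 le_rfl⟩) (measurable_pi_apply _))
  have h' := congrArg (fun η => η (fun _ => x) {y}) h
  rwa [Kernel.map_apply' _ (measurable_pi_apply _) _ (measurableSet_singleton y),
    Kernel.comap_apply] at h'

lemma pathKernel_cylinder_one (x : V) (v : ℕ → V) :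
    pathKernel κ x (PiNat.cylinder v 1) = Measure.dirac x {v 0} := by
  classical
  have h : PiNat.cylinder v 1 =ᵐ[pathKernel κ x] {_w | x = v 0} := by
    refine Filter.eventuallyEq_set.2 ((ae_pathKernel_zero κ x).mono fun w hw => ?_)
    simp only [PiNat.mem_cylinder_iff, Nat.lt_one_iff, forall_eq, hw, Set.mem_ofPred_eq]
  rw [measure_congr h]
  by_cases hx : x = v 0 <;> simp [hx]

variable [Countable V]

lemma pathKernel_cylinder_succ (x : V) (v : ℕ → V) (n : ℕ) :
    pathKernel κ x (PiNat.cylinder v (n + 2)) =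
      pathKernel κ x (PiNat.cylinder v (n + 1)) * κ (v n) {v (n + 1)} := by
  have hfactor := Kernel.partialTraj_compProd_eq_map_traj (X := fun _ => V)
    (κ := fun n => κ.comap
      (fun h : (i : Finset.Iic n) → V => h ⟨n, Finset.mem_Iic.2 le_rfl⟩) (measurable_pi_apply _))
    (Nat.zero_le n) (x₀ := fun _ => x)
  rw [← Kernel.traj_map_frestrictLe_apply] at hfactor
  have hcyl : PiNat.cylinder v (n + 2) =
      (fun w : ℕ → V => (Preorder.frestrictLe (π := fun _ => V) n w, w (n + 1))) ⁻¹'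
        ({Preorder.frestrictLe (π := fun _ => V) n v} ×ˢ {v (n + 1)}) := by
    ext w
    rw [Set.mk_preimage_prod, ← cylinder_succ_eq_preimage_frestrictLe]
    simp only [PiNat.mem_cylinder_iff, Set.mem_inter_iff, Set.mem_preimage,
      Set.mem_singleton_iff]
    exact Nat.forall_lt_succ_right
  rw [hcyl, cylinder_succ_eq_preimage_frestrictLe, pathKernel, Kernel.comap_apply,
    ← Measure.map_apply (by fun_prop)
      ((measurableSet_singleton _).prod (measurableSet_singleton _)),
    ← Measure.map_apply (by fun_prop) (measurableSet_singleton _), ← hfactor,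
    Measure.compProd_apply_prod (measurableSet_singleton _) (measurableSet_singleton _),
    Measure.restrict_singleton, lintegral_smul_measure, lintegral_dirac, smul_eq_mul]
  rfl

lemma pathKernel_cylinder_add (x : V) (v : ℕ → V) (n k : ℕ) :
    pathKernel κ x (PiNat.cylinder v (n + k + 1)) =
      pathKernel κ x (PiNat.cylinder v (n + 1)) *
        pathKernel κ (v n) (PiNat.cylinder (shiftPath n v) (k + 1)) := by
  induction k with
  | zero => simp [pathKernel_cylinder_one, shiftPath]
  | succ k ih =>
    rw [← add_assoc, pathKernel_cylinder_succ, ih, pathKernel_cylinder_succ, mul_assoc]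
    rfl

lemma markov_property (n : ℕ) (x : V) :
    (pathKernel κ x ⊗ₘ (pathKernel κ).comap (fun b => b n) (measurable_pi_apply n)).map
      (fun p => splice n p.1 p.2) = pathKernel κ x := by
  classical
  refine ext_of_cylinder n fun v m hm => ?_
  obtain ⟨k, rfl⟩ := Nat.exists_eq_add_of_le hm
  have hcond (b : ℕ → V) : pathKernel κ (b n)
      {w | splice n b w ∈ PiNat.cylinder v (n + k + 1)} =
      (PiNat.cylinder v (n + 1)).indicator
        (fun _ => pathKernel κ (v n) (PiNat.cylinder (shiftPath n v) (k + 1))) b := by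
    have hset : {w | splice n b w ∈ PiNat.cylinder v (n + k + 1)} =ᵐ[pathKernel κ (b n)]
        {w | b ∈ PiNat.cylinder v (n + 1) ∧ w ∈ PiNat.cylinder (shiftPath n v) (k + 1)} :=
      Filter.eventuallyEq_set.2 <|
        (ae_pathKernel_zero κ (b n)).mono fun w hw => splice_mem_cylinder_iff hw
    rw [measure_congr hset]
    by_cases hb : b ∈ PiNat.cylinder v (n + 1)
    · simp only [hb, true_and, Set.ofPred_mem_eq, Set.indicator_of_mem, hb n n.lt_succ_self]
    · simp only [hb, false_and, Set.ofPred_false, measure_empty, Set.indicator_of_notMem,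
        not_false_eq_true]
  rw [Measure.map_apply (measurable_splice n) (measurableSet_cylinder v _),
    Measure.compProd_apply (measurable_splice n (measurableSet_cylinder v _))]
  simp only [Kernel.comap_apply]
  refine (lintegral_congr hcond).trans ?_
  rw [lintegral_indicator_const (measurableSet_cylinder v _), pathKernel_cylinder_add, mul_comm]

lemma lintegral_pathKernel_splice (n : ℕ) (x : V) {f : (ℕ → V) → ℝ≥0∞} (hf : Measurable f) :
    ∫⁻ w, f w ∂pathKernel κ x =
      ∫⁻ b, ∫⁻ w, f (splice n b w) ∂pathKernel κ (b n) ∂pathKernel κ x := by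
  conv_lhs => rw [← markov_property κ n x]
  rw [lintegral_map hf (measurable_splice n),
    Measure.lintegral_compProd (f := fun p => f (splice n p.1 p.2))
      (hf.comp (measurable_splice n))]
  rfl

lemma lintegral_pathKernel_consPath (x : V) {f : (ℕ → V) → ℝ≥0∞} (hf : Measurable f) :
    ∫⁻ w, f w ∂pathKernel κ x =
      ∑' y, κ x {y} * ∫⁻ w, f (consPath x w) ∂pathKernel κ y := by
  have h : ∀ᵐ b ∂pathKernel κ x, ∫⁻ w, f (splice 1 b w) ∂pathKernel κ (b 1) =
      ∫⁻ w, f (consPath x w) ∂pathKernel κ (b 1) := by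
    filter_upwards [ae_pathKernel_zero κ x] with b hb
    simp_rw [splice_one, hb]
  rw [lintegral_pathKernel_splice κ 1 x hf, lintegral_congr_ae h,
    ← lintegral_map (f := fun y => ∫⁻ w, f (consPath x w) ∂pathKernel κ y)
      (g := fun b : ℕ → V => b 1) Measurable.of_discrete (by fun_prop), lintegral_countable']
  refine tsum_congr fun y => ?_
  rw [Measure.map_apply (by fun_prop) (measurableSet_singleton y), mul_comm, ← transProb_one]
  rfl

lemma pathKernel_inter_shiftPath (n : ℕ) (x y : V) {A : Set (ℕ → V)} (hA : MeasurableSet A) :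
    pathKernel κ x {w | w n = y ∧ shiftPath n w ∈ A} =
      transProb κ n x y * pathKernel κ y A := by
  classical
  have hm : MeasurableSet {w : ℕ → V | w n = y ∧ shiftPath n w ∈ A} :=
    (measurableSet_eval_eq n y).inter (measurable_shiftPath n hA)
  have hcond (b : ℕ → V) : pathKernel κ (b n) {w | w 0 = y ∧ w ∈ A} =
      {w : ℕ → V | w n = y}.indicator (fun _ => pathKernel κ y A) b := by
    have hset : {w | w 0 = y ∧ w ∈ A} =ᵐ[pathKernel κ (b n)] {w | b n = y ∧ w ∈ A} :=
      Filter.eventuallyEq_set.2 <|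
        (ae_pathKernel_zero κ (b n)).mono fun w hw => by simp only [Set.mem_ofPred_eq, hw]
    rw [measure_congr hset]
    by_cases hb : b n = y <;> simp [hb]
  conv_lhs => rw [← markov_property κ n x]
  rw [Measure.map_apply (measurable_splice n) hm,
    Measure.compProd_apply (measurable_splice n hm)]
  simp only [Set.preimage_ofPred_eq, splice_self, shiftPath_splice, Kernel.comap_apply]
  refine (lintegral_congr hcond).trans ?_
  rw [lintegral_indicator_const (measurableSet_eval_eq n y), mul_comm, transProb]

lemma chapman_kolmogorov (n m : ℕ) (x y : V) :
    transProb κ (n + m) x y = ∑' z, transProb κ n x z * transProb κ m z y := by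
  have hU : {w : ℕ → V | w (n + m) = y} =
      ⋃ z, {w | w n = z ∧ shiftPath n w ∈ {w : ℕ → V | w m = y}} := by
    ext w
    simp [shiftPath]
  rw [transProb, hU, measure_iUnion]
  · exact tsum_congr fun z => pathKernel_inter_shiftPath κ n x z (measurableSet_eval_eq m y)
  · exact fun z z' hzz' => Set.disjoint_left.2 fun w hw hw' => hzz' (hw.1.symm.trans hw'.1)
  · exact fun z => (measurableSet_eval_eq n z).inter
      (measurable_shiftPath n (measurableSet_eval_eq m y))

lemma mul_transProb_le (n m : ℕ) (x z y : V) :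
    transProb κ n x z * transProb κ m z y ≤ transProb κ (n + m) x y := by
  rw [chapman_kolmogorov]
  exact ENNReal.le_tsum z

lemma green_self_mul_noReturn {y : V} (h : ∀ᵐ w ∂pathKernel κ y, {n : ℕ | w n = y}.Finite) :
    green κ y y * pathKernel κ y (noReturn {y}) = 1 := by
  have hcover : pathKernel κ y (⋃ m, lastVisit y m) = 1 := by
    refine (mem_ae_iff_prob_eq_one (MeasurableSet.iUnion (measurableSet_lastVisit y))).1 ?_
    filter_upwards [h, ae_pathKernel_zero κ y] with w hw h0
    exact Set.mem_iUnion.2 (exists_mem_lastVisit ⟨0, h0⟩ hw)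
  rw [← hcover, measure_iUnion (pairwise_disjoint_lastVisit y) (measurableSet_lastVisit y),
    green, ← ENNReal.tsum_mul_right]
  exact tsum_congr fun m =>
    (pathKernel_inter_shiftPath κ m y y (measurableSet_noReturn {y})).symm

lemma green_self_ne_top {y : V} (h : ∀ᵐ w ∂pathKernel κ y, {n : ℕ | w n = y}.Finite) :
    green κ y y ≠ ∞ := by
  intro ht
  have h1 := green_self_mul_noReturn κ h
  rw [ht] at h1
  by_cases h0 : pathKernel κ y (noReturn {y}) = 0 <;> simp [h0] at h1

lemma ae_finite_visits {y : V} (h : ∀ᵐ w ∂pathKernel κ y, {n : ℕ | w n = y}.Finite) (x : V) :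
    ∀ᵐ w ∂pathKernel κ x, {n : ℕ | w n = y}.Finite := by
  obtain ⟨N, hsub, hN, hN0⟩ := exists_measurable_superset_of_null h
  have hnull (n : ℕ) : pathKernel κ x {w | w n = y ∧ shiftPath n w ∈ N} = 0 := by
    rw [pathKernel_inter_shiftPath κ n x y hN, hN0, mul_zero]
  have hall := ae_all_iff.2 fun n => (measure_eq_zero_iff_ae_notMem).1 (hnull n)
  filter_upwards [hall] with w hw
  by_contra hinf
  obtain ⟨n, hn⟩ := Set.Infinite.nonempty hinf
  refine hw n ⟨hn, hsub fun hfin => hinf ?_⟩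
  refine ((Set.finite_lt_nat n).union (hfin.image (n + ·))).subset fun i hi => ?_
  rcases lt_or_ge i n with hin | hin
  · exact Or.inl hin
  · exact Or.inr ⟨i - n, by simpa [shiftPath, Nat.add_sub_cancel' hin] using hi, by simp [hin]⟩

end MarkovChain

/-! ### The two-sided chain -/

section BiinfiniteSequences

variable {V : Type*}

/-- The time shift by `k` of a biinfinite sequence. -/
def shiftZ (k : ℤ) (w : ℤ → V) : ℤ → V := fun n => w (n + k)

/-- The biinfinite sequences that visit `u` for the first time at time `m`. -/
def firstVisit (u : V) (m : ℤ) : Set (ℤ → V) := {w | w m = u ∧ ∀ n < m, w n ≠ u}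

/-- The number of visits of a biinfinite sequence to `u`. -/
def visitCount (u : V) (w : ℤ → V) : ℝ≥0∞ := ∑' n, {w : ℤ → V | w n = u}.indicator 1 w

lemma glue_neg (p : (ℕ → V) × (ℕ → V)) (j : ℕ) : glue p (-(j : ℤ)) = p.1 j := by
  simp [glue]

@[simp] lemma glue_zero (p : (ℕ → V) × (ℕ → V)) : glue p 0 = p.1 0 := glue_neg p 0

lemma glue_of_pos (p : (ℕ → V) × (ℕ → V)) {j : ℕ} (hj : 0 < j) : glue p (j : ℤ) = p.2 j := by
  simp [glue, hj.ne']

lemma glue_natCast {p : (ℕ → V) × (ℕ → V)} (h : p.1 0 = p.2 0) (j : ℕ) :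
    glue p (j : ℤ) = p.2 j := by
  rcases j.eq_zero_or_pos with rfl | hj
  · simpa using h
  · exact glue_of_pos p hj

lemma shiftZ_one_glue_consPath {x y : V} {α β : ℕ → V} (hβ : β 0 = y) :
    shiftZ 1 (glue (α, consPath x β)) = glue (consPath y α, β) := by
  funext n
  obtain ⟨j, rfl | rfl⟩ := n.eq_nat_or_neg
  · rw [glue_natCast hβ.symm]
    exact glue_of_pos _ j.succ_pos
  · rw [glue_neg]
    cases j with
    | zero => exact (glue_of_pos _ Nat.one_pos).trans hβ
    | succ j =>
      rw [shiftZ, show -((j + 1 : ℕ) : ℤ) + 1 = -(j : ℤ) by push_cast; ring, glue_neg]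
      rfl

lemma preimage_glue_forall_lt_zero (K : Finset V) :
    glue ⁻¹' {w | ∀ n < 0, w n ∉ K} = noReturn K ×ˢ (Set.univ : Set (ℕ → V)) := by
  ext p
  simp only [Set.mem_preimage, Set.mem_ofPred_eq, noReturn, Set.mem_prod, Set.mem_univ, and_true]
  refine ⟨fun h n hn => glue_neg p n ▸ h (-n) (by omega), fun h n hn => ?_⟩
  obtain ⟨j, hj⟩ := Int.eq_ofNat_of_zero_le (show 0 ≤ -n by omega)
  obtain rfl : n = -(j : ℤ) := by omega
  exact glue_neg p j ▸ h j (by omega)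

lemma shiftZ_iterate (n : ℕ) : (shiftZ (V := V) 1)^[n] = shiftZ n := by
  induction n with
  | zero => funext w k; simp [shiftZ]
  | succ n ih =>
    funext w k
    simp [ih, shiftZ, add_assoc]

lemma shiftZ_mem_firstVisit_iff {u : V} {m k : ℤ} {w : ℤ → V} :
    shiftZ k w ∈ firstVisit u m ↔ w ∈ firstVisit u (m + k) := by
  refine and_congr_right fun _ => ⟨fun h n hn => ?_, fun h n hn => h _ (by omega)⟩
  simpa [shiftZ] using h (n - k) (by omega)

lemma pairwise_disjoint_firstVisit (u : V) :
    Pairwise (Function.onFun Disjoint (firstVisit u)) := by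
  intro m n hmn
  refine Set.disjoint_left.2 fun w hm hn => ?_
  rcases lt_or_gt_of_ne hmn with h | h
  · exact hn.2 m h hm.1
  · exact hm.2 n h hn.1

lemma exists_mem_firstVisit_neg {u : V} {w : ℤ → V} (h0 : w 0 = u)
    (hf : {n | w n = u}.Finite) : ∃ m : ℕ, w ∈ firstVisit u (-(m : ℤ)) := by
  obtain ⟨m, hm, hmin⟩ := Set.exists_min_image _ id hf ⟨0, h0⟩
  have hm0 : m ≤ 0 := hmin 0 h0
  refine ⟨m.natAbs, ?_⟩
  rw [Int.ofNat_natAbs_of_nonpos hm0, neg_neg]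
  exact ⟨hm, fun n hn h => hn.not_ge (hmin n h)⟩

lemma visitCount_shiftZ (u : V) (k : ℤ) (w : ℤ → V) :
    visitCount u (shiftZ k w) = visitCount u w :=
  (Equiv.addRight k).tsum_eq fun n => {w : ℤ → V | w n = u}.indicator (1 : (ℤ → V) → ℝ≥0∞) w

lemma visitCount_eq_tsum_nat_of_mem_firstVisit {u : V} {w : ℤ → V} (hw : w ∈ firstVisit u 0) :
    visitCount u w = ∑' n : ℕ, {w : ℤ → V | w n = u}.indicator 1 w := by
  have hneg (j : ℕ) :
      {w : ℤ → V | w (-((j : ℤ) + 1)) = u}.indicator (1 : (ℤ → V) → ℝ≥0∞) w = 0 :=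
    Set.indicator_of_notMem (s := {w : ℤ → V | _}) (hw.2 (-((j : ℤ) + 1)) (by omega)) _
  rw [visitCount, tsum_of_nat_of_neg_add_one ENNReal.summable ENNReal.summable]
  simp only [hneg, tsum_zero, add_zero]

variable [MeasurableSpace V]

@[fun_prop]
lemma measurable_glue : Measurable (glue (V := V)) := by
  refine measurable_pi_iff.2 fun n => ?_
  unfold glue
  split_ifs <;> fun_prop

@[fun_prop]
lemma measurable_shiftZ (k : ℤ) : Measurable (shiftZ (V := V) k) := by
  unfold shiftZ
  fun_prop

variable [DiscreteMeasurableSpace V]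

lemma measurableSet_firstVisit (u : V) (m : ℤ) : MeasurableSet (firstVisit u m) := by
  have : firstVisit u m = {w | w m = u} ∩ ⋂ n : Set.Iio m, {w | w n = u}ᶜ := by
    ext w
    simp [firstVisit]
  rw [this]
  exact (measurableSet_eval_eq m u).inter
    (MeasurableSet.iInter fun n => (measurableSet_eval_eq (n : ℤ) u).compl)

lemma measurableSet_forall_lt_zero_notMem (s : Set V) :
    MeasurableSet {w : ℤ → V | ∀ n < 0, w n ∉ s} := by
  have : {w : ℤ → V | ∀ n < 0, w n ∉ s} = ⋂ n : Set.Iio (0 : ℤ), (fun w : ℤ → V => w n) ⁻¹' sᶜ := by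
    ext w
    simp
  rw [this]
  exact MeasurableSet.iInter fun n => measurable_pi_apply (n : ℤ) MeasurableSet.of_discrete

lemma measurable_visitCount (u : V) : Measurable (visitCount u) :=
  Measurable.tsum fun n => measurable_one.indicator (measurableSet_eval_eq n u)

/-- Mass transport: every visit to `u` sends its mass to the first visit to `u`. -/
lemma measure_inter_eval_zero_eq_lintegral_visitCount {M : Measure (ℤ → V)}
    (hM : ∀ n : ℕ, MeasurePreserving (shiftZ n) M M) {B : Set (ℤ → V)} (hB : MeasurableSet B)
    (hBshift : ∀ n : ℕ, shiftZ n ⁻¹' B = B) {u : V} (hBfin : ∀ w ∈ B, {n | w n = u}.Finite) :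
    M (B ∩ {w | w 0 = u}) = ∫⁻ w in B ∩ firstVisit u 0, visitCount u w ∂M := by
  have hBF (m : ℤ) : MeasurableSet (B ∩ firstVisit u m) := hB.inter (measurableSet_firstVisit u m)
  have hmeas (m : ℕ) : MeasurableSet (B ∩ firstVisit u (-m) ∩ {w | w 0 = u}) :=
    (hBF _).inter (measurableSet_eval_eq 0 u)
  have hcover : B ∩ {w | w 0 = u} = ⋃ m : ℕ, B ∩ firstVisit u (-m) ∩ {w | w 0 = u} := by
    refine Set.Subset.antisymm (fun w ⟨hw, h0⟩ => ?_)
      (Set.iUnion_subset fun m w hw => ⟨hw.1.1, hw.2⟩)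
    obtain ⟨m, hm⟩ := exists_mem_firstVisit_neg h0 (hBfin w hw)
    exact Set.mem_iUnion.2 ⟨m, ⟨hw, hm⟩, h0⟩
  have hdisj : Pairwise (Function.onFun Disjoint
      fun m : ℕ => B ∩ firstVisit u (-(m : ℤ)) ∩ {w | w 0 = u}) := fun m n hmn =>
    (pairwise_disjoint_firstVisit u (show -(m : ℤ) ≠ -n by omega)).mono
      (fun _ hw => hw.1.2) (fun _ hw => hw.1.2)
  have hshift (m : ℕ) : shiftZ m ⁻¹' (B ∩ firstVisit u (-m) ∩ {w | w 0 = u}) =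
      {w | w m = u} ∩ (B ∩ firstVisit u 0) := by
    ext w
    have := Set.ext_iff.1 (hBshift m) w
    simp only [Set.mem_preimage, Set.mem_inter_iff, shiftZ_mem_firstVisit_iff, neg_add_cancel]
      at this ⊢
    simp only [this, shiftZ, Set.mem_ofPred_eq, zero_add, and_comm]
  calc M (B ∩ {w | w 0 = u})
      = ∑' m : ℕ, M ({w | w m = u} ∩ (B ∩ firstVisit u 0)) := by
        rw [hcover, measure_iUnion hdisj hmeas]
        exact tsum_congr fun m => by
          rw [← (hM m).measure_preimage (hmeas m).nullMeasurableSet, hshift]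
    _ = ∑' m : ℕ, ∫⁻ w in B ∩ firstVisit u 0, {w : ℤ → V | w m = u}.indicator 1 w ∂M :=
        tsum_congr fun m => by
          rw [lintegral_indicator_one (measurableSet_eval_eq _ u),
            Measure.restrict_apply (measurableSet_eval_eq _ u)]
    _ = ∫⁻ w in B ∩ firstVisit u 0, visitCount u w ∂M := by
        rw [← lintegral_tsum fun m : ℕ =>
          (measurable_one.indicator (measurableSet_eval_eq _ u)).aemeasurable]
        exact setLIntegral_congr_fun (hBF 0) fun w hw =>
          (visitCount_eq_tsum_nat_of_mem_firstVisit hw.2).symm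

end BiinfiniteSequences

section TwoSidedChain

variable {V : Type*} [MeasurableSpace V] (κ : Kernel V V) [IsMarkovKernel κ]

/-- The law of the biinfinite sequence obtained by gluing two independent chains started at `x`,
the first one run backwards in time. -/
def twoSidedLaw (x : V) : Measure (ℤ → V) :=
  ((pathKernel κ x).prod (pathKernel κ x)).map glue

instance (x : V) : IsProbabilityMeasure (twoSidedLaw κ x) :=
  Measure.isProbabilityMeasure_map measurable_glue.aemeasurable

/-- The (infinite) law of the two-sided chain whose position at time `0` is distributed according
to the weights `m`; it is stationary when `m` is reversible for `κ`. -/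
def twoSidedMeasure (m : V → ℝ≥0∞) : Measure (ℤ → V) :=
  Measure.sum fun x => m x • twoSidedLaw κ x

lemma ae_prod_pathKernel {x : V} {Q : (ℕ → V) → Prop} (h : ∀ᵐ w ∂pathKernel κ x, Q w) :
    ∀ᵐ p ∂(pathKernel κ x).prod (pathKernel κ x), Q p.1 ∧ Q p.2 :=
  (Measure.quasiMeasurePreserving_fst.ae h).and (Measure.quasiMeasurePreserving_snd.ae h)

lemma lintegral_twoSidedLaw (x : V) {f : (ℤ → V) → ℝ≥0∞} (hf : Measurable f) :
    ∫⁻ w, f w ∂twoSidedLaw κ x =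
      ∫⁻ α, ∫⁻ β, f (glue (α, β)) ∂pathKernel κ x ∂pathKernel κ x := by
  rw [twoSidedLaw, lintegral_map hf measurable_glue,
    lintegral_prod (fun p => f (glue p)) (by fun_prop)]

variable [DiscreteMeasurableSpace V]

lemma ae_twoSidedLaw_zero (x : V) : ∀ᵐ w ∂twoSidedLaw κ x, w 0 = x := by
  refine (ae_map_iff measurable_glue.aemeasurable (measurableSet_eval_eq 0 x)).2 ?_
  filter_upwards [ae_prod_pathKernel κ (ae_pathKernel_zero κ x)] with p hp
  simpa using hp.1

lemma twoSidedLaw_eval_eq (x u : V) (n : ℤ) :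
    twoSidedLaw κ x {w | w n = u} = transProb κ n.natAbs x u := by
  have h0 := ae_prod_pathKernel κ (ae_pathKernel_zero κ x)
  rw [twoSidedLaw, Measure.map_apply measurable_glue (measurableSet_eval_eq n u)]
  obtain ⟨j, rfl | rfl⟩ := n.eq_nat_or_neg
  · have h : glue ⁻¹' {w | w (j : ℤ) = u} =ᵐ[(pathKernel κ x).prod (pathKernel κ x)]
        Set.univ ×ˢ {w : ℕ → V | w j = u} :=
      Filter.eventuallyEq_set.2 <| h0.mono fun p hp => by
        simp [glue_natCast (hp.1.trans hp.2.symm)]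
    rw [measure_congr h, Measure.prod_prod]
    simp [transProb]
  · have h : glue ⁻¹' {w | w (-(j : ℤ)) = u} = {w : ℕ → V | w j = u} ×ˢ Set.univ := by
      ext p
      simp [glue_neg]
    rw [h, Measure.prod_prod]
    simp [transProb]

lemma lintegral_visitCount_le (u v : V) :
    ∫⁻ w, visitCount u w ∂twoSidedLaw κ v ≤ 2 * green κ v u := by
  have hcount : ∫⁻ w, visitCount u w ∂twoSidedLaw κ v = ∑' n : ℤ, transProb κ n.natAbs v u := by
    unfold visitCount
    rw [lintegral_tsum fun n => (measurable_one.indicator (measurableSet_eval_eq n u)).aemeasurable]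
    exact tsum_congr fun n => by
      rw [lintegral_indicator_one (measurableSet_eval_eq n u), twoSidedLaw_eval_eq]
  have hnatAbs (n : ℕ) : (-((n : ℤ) + 1)).natAbs = n + 1 := by omega
  rw [hcount, tsum_of_nat_of_neg_add_one ENNReal.summable ENNReal.summable, two_mul]
  simp only [Int.natAbs_natCast, hnatAbs]
  exact add_le_add le_rfl
    (ENNReal.tsum_comp_le_tsum_of_injective (add_left_injective 1) fun n => transProb κ n v u)

lemma restrict_twoSidedMeasure (m : V → ℝ≥0∞) (u : V) :
    (twoSidedMeasure κ m).restrict {w | w 0 = u} = m u • twoSidedLaw κ u := by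
  classical
  have hrestrict (x : V) : (m x • twoSidedLaw κ x).restrict {w | w 0 = u} =
      if x = u then m u • twoSidedLaw κ u else 0 := by
    split_ifs with hx
    · subst hx
      rw [Measure.restrict_smul, Measure.restrict_eq_self_of_ae_mem
        (s := {w : ℤ → V | w 0 = x}) (ae_twoSidedLaw_zero κ x)]
    · rw [Measure.restrict_smul, Measure.restrict_eq_zero.2, smul_zero]
      exact measure_mono_null (fun w (hw : w 0 = u) (h : w 0 = x) => hx (h.symm.trans hw))
        (ae_twoSidedLaw_zero κ x)
  ext A hA
  rw [twoSidedMeasure, Measure.restrict_sum _ (measurableSet_eval_eq 0 u), Measure.sum_apply _ hA,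
    tsum_eq_single u fun x hx => by simp [hrestrict, hx]]
  simp [hrestrict]

variable [Countable V]

lemma lintegral_twoSidedLaw_eq_tsum (y : V) {f : (ℤ → V) → ℝ≥0∞} (hf : Measurable f) :
    ∫⁻ w, f w ∂twoSidedLaw κ y = ∑' x, κ y {x} *
      ∫⁻ α, ∫⁻ β, f (glue (consPath y α, β)) ∂pathKernel κ y ∂pathKernel κ x := by
  rw [lintegral_twoSidedLaw κ y hf]
  exact lintegral_pathKernel_consPath κ y
    (f := fun α => ∫⁻ β, f (glue (α, β)) ∂pathKernel κ y)
    (hf.comp measurable_glue).lintegral_prod_right'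

lemma lintegral_shiftZ_one_twoSidedLaw (x : V) {f : (ℤ → V) → ℝ≥0∞} (hf : Measurable f) :
    ∫⁻ w, f (shiftZ 1 w) ∂twoSidedLaw κ x = ∑' y, κ x {y} *
      ∫⁻ α, ∫⁻ β, f (glue (consPath y α, β)) ∂pathKernel κ y ∂pathKernel κ x := by
  have hmeas (y : V) :
      Measurable fun α => ∫⁻ β, f (glue (consPath y α, β)) ∂pathKernel κ y :=
    Measurable.lintegral_prod_right'
      (f := fun p : (ℕ → V) × (ℕ → V) => f (glue (consPath y p.1, p.2))) (by fun_prop)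
  have hinner (α : ℕ → V) : ∫⁻ β, f (shiftZ 1 (glue (α, β))) ∂pathKernel κ x =
      ∑' y, κ x {y} * ∫⁻ β, f (glue (consPath y α, β)) ∂pathKernel κ y := by
    rw [lintegral_pathKernel_consPath κ x (f := fun β => f (shiftZ 1 (glue (α, β))))
      (by fun_prop)]
    refine tsum_congr fun y => ?_
    congr 1
    refine lintegral_congr_ae ?_
    filter_upwards [ae_pathKernel_zero κ y] with β hβ
    rw [shiftZ_one_glue_consPath hβ]
  rw [lintegral_twoSidedLaw κ x (f := fun w => f (shiftZ 1 w)) (by fun_prop)]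
  simp_rw [hinner]
  rw [lintegral_tsum fun y => ((hmeas y).const_mul _).aemeasurable]
  exact tsum_congr fun y => lintegral_const_mul _ (hmeas y)

variable {κ} {m : V → ℝ≥0∞} (hm : ∀ x y, m x * κ x {y} = m y * κ y {x})
include hm

lemma measurePreserving_shiftZ_twoSidedMeasure (n : ℕ) :
    MeasurePreserving (shiftZ n) (twoSidedMeasure κ m) (twoSidedMeasure κ m) := by
  rw [← shiftZ_iterate]
  refine MeasurePreserving.iterate ⟨measurable_shiftZ 1, ?_⟩ n
  refine Measure.ext_of_lintegral _ fun f hf => ?_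
  rw [lintegral_map hf (measurable_shiftZ 1)]
  simp_rw [twoSidedMeasure, lintegral_sum_measure, lintegral_smul_measure, smul_eq_mul,
    lintegral_shiftZ_one_twoSidedLaw κ _ hf, lintegral_twoSidedLaw_eq_tsum κ _ hf,
    ← ENNReal.tsum_mul_left, ← mul_assoc]
  rw [ENNReal.tsum_comm]
  exact tsum_congr fun y => tsum_congr fun x => by rw [hm x y]

lemma mul_twoSidedLaw_eq_lintegral_visitCount {B : Set (ℤ → V)} (hB : MeasurableSet B)
    (hBshift : ∀ n : ℕ, shiftZ n ⁻¹' B = B) {u : V} (hBfin : ∀ w ∈ B, {n | w n = u}.Finite) :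
    m u * twoSidedLaw κ u B =
      m u * ∫⁻ w in B ∩ {w | ∀ n < 0, w n ≠ u}, visitCount u w ∂twoSidedLaw κ u := by
  have hF : B ∩ firstVisit u 0 = B ∩ {w | ∀ n < 0, w n ≠ u} ∩ {w | w 0 = u} := by
    ext w
    simp only [firstVisit, Set.mem_inter_iff, Set.mem_ofPred_eq]
    tauto
  have hneg : MeasurableSet {w : ℤ → V | ∀ n < 0, w n ≠ u} :=
    measurableSet_forall_lt_zero_notMem {u}
  have h := measure_inter_eval_zero_eq_lintegral_visitCount
    (measurePreserving_shiftZ_twoSidedMeasure hm) hB hBshift hBfin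
  rw [hF, ← Measure.restrict_restrict (hB.inter hneg), ← Measure.restrict_apply hB,
    restrict_twoSidedMeasure] at h
  simpa only [Measure.smul_apply, Measure.restrict_smul, lintegral_smul_measure, smul_eq_mul]
    using h

lemma mul_transProb_comm (n : ℕ) (x y : V) : m x * transProb κ n x y = m y * transProb κ n y x := by
  induction n generalizing x y with
  | zero =>
    by_cases hxy : x = y
    · rw [hxy]
    · have h0 {x y : V} (h : x ≠ y) : transProb κ 0 x y = 0 :=
        measure_mono_null (fun w (hw : w 0 = y) (hw' : w 0 = x) => h (hw'.symm.trans hw))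
          (ae_pathKernel_zero κ x)
      rw [h0 hxy, h0 (Ne.symm hxy), mul_zero, mul_zero]
  | succ n ih =>
    rw [add_comm n 1, chapman_kolmogorov, add_comm 1 n, chapman_kolmogorov,
      ← ENNReal.tsum_mul_left, ← ENNReal.tsum_mul_left]
    refine tsum_congr fun z => ?_
    rw [← mul_assoc, transProb_one, hm x z, mul_right_comm, ih z y, transProb_one, mul_assoc]

end TwoSidedChain

/-! ### The conductance chain -/

section TransientRays

variable {V : Type*} {G : SimpleGraph V}

/-- The nearest-neighbour sequences that visit every vertex finitely often: the one-sided analogue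
of `trajSet`. -/
def transientRays (G : SimpleGraph V) : Set (ℕ → V) :=
  {w | (∀ n, G.Adj (w n) (w (n + 1))) ∧ ∀ x, {n | w n = x}.Finite}

lemma shiftPath_mem_transientRays {w : ℕ → V} (hw : w ∈ transientRays G) (n : ℕ) :
    shiftPath n w ∈ transientRays G :=
  ⟨fun i => hw.1 (n + i), fun x => (hw.2 x).preimage (add_right_injective n).injOn⟩

end TransientRays

section WeightedGraph

variable {V : Type*} [MeasurableSpace V] [DiscreteMeasurableSpace V] {G : SimpleGraph V}
  [G.LocallyFinite] {a : V → V → ℝ≥0}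

lemma totalWeight_mul_step [DecidableRel G.Adj] (x y : V) :
    (totalWeight G a x : ℝ≥0∞) * step G a x {y} = if G.Adj x y then (a x y : ℝ≥0∞) else 0 := by
  classical
  by_cases h0 : totalWeight G a x = 0
  · have hzero : G.Adj x y → 0 = a x y := fun h =>
      (Finset.sum_eq_zero_iff.1 h0 y ((G.mem_neighborFinset x y).2 h)).symm
    simpa [h0] using hzero
  · have h0' : (totalWeight G a x : ℝ≥0∞) ≠ 0 := by exact_mod_cast h0
    simp only [step, Kernel.coe_mk, h0, if_false, Measure.coe_finsetSum, Finset.sum_apply,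
      Measure.smul_apply, smul_eq_mul,
      ENNReal.mul_div_cancel h0' ENNReal.coe_ne_top, Measure.dirac_apply, Set.indicator_apply,
      Set.mem_singleton_iff, Pi.one_apply, mul_ite, mul_one, mul_zero, Finset.sum_ite_eq',
      SimpleGraph.mem_neighborFinset]

lemma totalWeight_mul_step_comm (ha_symm : ∀ x y, a x y = a y x) (x y : V) :
    (totalWeight G a x : ℝ≥0∞) * step G a x {y} = totalWeight G a y * step G a y {x} := by
  classical
  rw [totalWeight_mul_step, totalWeight_mul_step, G.adj_comm, ha_symm]

namespace IsTransient

variable [Countable V] (htrans : IsTransient G a)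
include htrans

lemma green_self_ne_top (x : V) : green (step G a) x x ≠ ∞ :=
  Interlacement.green_self_ne_top (step G a) (htrans x)

lemma totalWeight_ne_zero (x : V) : (totalWeight G a x : ℝ≥0∞) ≠ 0 := by
  intro h0
  have hstay : step G a x {x} = 1 := by
    simp [step, show totalWeight G a x = 0 by exact_mod_cast h0]
  have htransProb (n : ℕ) : 1 ≤ transProb (step G a) n x x := by
    induction n with
    | zero => exact ((mem_ae_iff_prob_eq_one (measurableSet_eval_eq 0 x)).1
        (ae_pathKernel_zero (step G a) x)).ge
    | succ n ih =>
      calc (1 : ℝ≥0∞) ≤ transProb (step G a) n x x * transProb (step G a) 1 x x := by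
            rwa [transProb_one, hstay, mul_one]
        _ ≤ transProb (step G a) (n + 1) x x := mul_transProb_le _ n 1 x x x
  refine htrans.green_self_ne_top x (top_le_iff.1 ?_)
  calc ∞ = ∑' _ : ℕ, (1 : ℝ≥0∞) := (ENNReal.tsum_const_eq_top_of_ne_zero one_ne_zero).symm
    _ ≤ green (step G a) x x := ENNReal.tsum_le_tsum htransProb

lemma step_eq_zero_of_not_adj {x y : V} (h : ¬ G.Adj x y) : step G a x {y} = 0 := by
  classical
  have hmul := totalWeight_mul_step (G := G) (a := a) x y
  rw [if_neg h] at hmul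
  exact (mul_eq_zero.1 hmul).resolve_left (htrans.totalWeight_ne_zero x)

lemma ae_adj (x : V) (n : ℕ) : ∀ᵐ w ∂pathKernel (step G a) x, G.Adj (w n) (w (n + 1)) := by
  have hcover : {w : ℕ → V | ¬ G.Adj (w n) (w (n + 1))} ⊆
      ⋃ p : {p : V × V // ¬ G.Adj p.1 p.2},
        {w | w n = p.1.1 ∧ shiftPath n w ∈ {w : ℕ → V | w 1 = p.1.2}} := fun w hw =>
    Set.mem_iUnion.2 ⟨⟨(w n, w (n + 1)), hw⟩, rfl, rfl⟩
  refine measure_mono_null hcover (measure_iUnion_null fun p => ?_)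
  have hp : transProb (step G a) 1 p.1.1 p.1.2 = 0 := by
    rw [transProb_one, htrans.step_eq_zero_of_not_adj p.2]
  rw [pathKernel_inter_shiftPath _ n x p.1.1 (measurableSet_eval_eq 1 p.1.2)]
  exact mul_eq_zero_of_right _ hp

lemma ae_mem_transientRays (x : V) : ∀ᵐ w ∂pathKernel (step G a) x, w ∈ transientRays G :=
  (ae_all_iff.2 (htrans.ae_adj x)).and
    (ae_all_iff.2 fun y => ae_finite_visits (step G a) (htrans y) x)

end IsTransient

end WeightedGraph

section TrajectoriesModuloShift

variable {V : Type*} {G : SimpleGraph V}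

/-- The set of biinfinite sequences underlying `Traj G`. -/
def trajSet (G : SimpleGraph V) : Set (ℤ → V) :=
  {w | (∀ n, G.Adj (w n) (w (n + 1))) ∧ ∀ x, {n : ℤ | w n = x}.Finite}

lemma glue_mem_trajSet {p : (ℕ → V) × (ℕ → V)} (h : p.1 0 = p.2 0)
    (h1 : p.1 ∈ transientRays G) (h2 : p.2 ∈ transientRays G) : glue p ∈ trajSet G := by
  refine ⟨fun n => ?_, fun x => ?_⟩
  · obtain ⟨j, rfl | rfl⟩ := n.eq_nat_or_neg
    · rw [show (j : ℤ) + 1 = (j + 1 : ℕ) by push_cast; ring, glue_natCast h, glue_natCast h]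
      exact h2.1 j
    · cases j with
      | zero => simpa [glue, h] using h2.1 0
      | succ j =>
        rw [show -((j + 1 : ℕ) : ℤ) + 1 = -(j : ℤ) by push_cast; ring, glue_neg, glue_neg]
        exact (h1.1 j).symm
  · refine (((h1.2 x).image fun j : ℕ => -(j : ℤ)).union
      ((h2.2 x).image fun j : ℕ => (j : ℤ))).subset fun n hn => ?_
    obtain ⟨j, rfl | rfl⟩ := n.eq_nat_or_neg
    · exact Or.inr ⟨j, (glue_natCast h j).symm.trans hn, rfl⟩
    · exact Or.inl ⟨j, (glue_neg p j).symm.trans hn, rfl⟩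

lemma shiftZ_mem_trajSet {w : ℤ → V} (k : ℤ) (hw : w ∈ trajSet G) : shiftZ k w ∈ trajSet G :=
  ⟨fun n => by simpa [shiftZ, add_right_comm] using hw.1 (n + k),
    fun x => (hw.2 x).preimage (f := fun n : ℤ => n + k) (add_left_injective k).injOn⟩

lemma shiftZ_mem_trajSet_iff {w : ℤ → V} (k : ℤ) : shiftZ k w ∈ trajSet G ↔ w ∈ trajSet G := by
  refine ⟨fun h => ?_, shiftZ_mem_trajSet k⟩
  convert shiftZ_mem_trajSet (-k) h using 1
  funext n
  simp [shiftZ]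

/-- The number of visits to `u` of a trajectory modulo time shift. -/
def visits (u : V) : TrajMod G → ℝ≥0∞ :=
  Quotient.lift (fun w : Traj G => visitCount u w.1) fun w w' ⟨k, hk⟩ => by
    rw [← visitCount_shiftZ u k w.1]
    exact congrArg (visitCount u) (funext hk)

lemma proj_preimage_hitSet (K : Finset V) : proj ⁻¹' hitSet G K = {w | Hits K w} := by
  refine Set.Subset.antisymm (fun w ⟨w', hw', h⟩ => ?_) fun w hw => ⟨w, hw, rfl⟩
  obtain ⟨k, hk⟩ := Quotient.exact (s := shiftSetoid G) h
  exact (hits_shift hk).1 hw'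

lemma iUnion_hitSet_singleton : ⋃ x, hitSet G {x} = Set.univ := by
  refine Set.eq_univ_of_forall fun c => ?_
  obtain ⟨w, rfl⟩ := Quotient.exists_rep c
  exact Set.mem_iUnion.2 ⟨w.1 0, w, ⟨0, Finset.mem_singleton_self _⟩, rfl⟩

section ToTrajMod

variable [Nonempty (TrajMod G)]

open Classical in
/-- The trajectory modulo time shift of a biinfinite sequence, with an arbitrary value outside
`trajSet G`. It allows one to work with measures on `ℤ → V`, which the trajectories carry. -/
def toTrajMod (w : ℤ → V) : TrajMod G :=
  if h : w ∈ trajSet G then proj ⟨w, h⟩ else Classical.arbitrary _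

lemma toTrajMod_of_mem {w : ℤ → V} (h : w ∈ trajSet G) : toTrajMod w = proj ⟨w, h⟩ := dif_pos h

lemma toTrajMod_shiftZ (k : ℤ) (w : ℤ → V) :
    (toTrajMod (shiftZ k w) : TrajMod G) = toTrajMod w := by
  by_cases h : w ∈ trajSet G
  · rw [toTrajMod_of_mem h, toTrajMod_of_mem (shiftZ_mem_trajSet k h)]
    exact Quotient.sound (s := shiftSetoid G) ⟨-k, fun n => by simp [shiftZ]⟩
  · rw [toTrajMod, toTrajMod, dif_neg h, dif_neg ((shiftZ_mem_trajSet_iff k).not.2 h)]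

lemma visits_toTrajMod {w : ℤ → V} (h : w ∈ trajSet G) (u : V) :
    visits u (toTrajMod w : TrajMod G) = visitCount u w := by
  rw [toTrajMod_of_mem h]
  rfl

end ToTrajMod

variable [MeasurableSpace V]

lemma measurable_proj : Measurable (proj (G := G)) := measurable_quotient_mk''

variable [DiscreteMeasurableSpace V]

lemma measurable_visits (u : V) : Measurable (visits (G := G) u) :=
  measurable_from_quotient.2 ((measurable_visitCount u).comp measurable_subtype_coe)

lemma measurableSet_apply_mem (K : Finset V) (n : ℤ) :
    MeasurableSet {w : Traj G | w.1 n ∈ K} :=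
  (measurable_pi_apply n).comp measurable_subtype_coe (MeasurableSet.of_discrete (s := (K : Set V)))

lemma measurableSet_hits (K : Finset V) : MeasurableSet {w : Traj G | Hits K w} := by
  simp only [Hits, Set.ofPred_exists]
  exact MeasurableSet.iUnion (measurableSet_apply_mem K)

lemma measurableSet_hitSet (K : Finset V) : MeasurableSet (hitSet G K) :=
  measurableSet_quotient.2 (proj_preimage_hitSet K ▸ measurableSet_hits K)

variable [Countable V]

variable (G) in
lemma measurableSet_trajSet : MeasurableSet (trajSet G) := by
  have hadj : MeasurableSet {w : ℤ → V | ∀ n, G.Adj (w n) (w (n + 1))} := by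
    rw [Set.ofPred_forall]
    exact MeasurableSet.iInter fun n =>
      (by fun_prop : Measurable fun w : ℤ → V => (w n, w (n + 1)))
        (MeasurableSet.of_discrete (s := {q : V × V | G.Adj q.1 q.2}))
  have hfinite : {w : ℤ → V | ∀ x, {n : ℤ | w n = x}.Finite} =
      ⋂ x, ⋃ s : Finset ℤ, ⋂ n : {n // n ∉ s}, {w : ℤ → V | w n = x}ᶜ := by
    ext w
    simp only [Set.mem_ofPred_eq, Set.mem_iInter, Set.mem_iUnion, Set.mem_compl_iff]
    refine forall_congr' fun x => ⟨fun h => ⟨h.toFinset, fun n hn => n.2 (by simpa using hn)⟩, ?_⟩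
    rintro ⟨s, hs⟩
    exact s.finite_toSet.subset fun n hn => by_contra fun hns => hs ⟨n, hns⟩ hn
  refine hadj.inter ?_
  change MeasurableSet {w : ℤ → V | ∀ x, {n : ℤ | w n = x}.Finite}
  rw [hfinite]
  exact MeasurableSet.iInter fun x => MeasurableSet.iUnion fun s =>
    MeasurableSet.iInter fun n => (measurableSet_eval_eq (n : ℤ) x).compl

variable [Nonempty (TrajMod G)]

@[fun_prop]
lemma measurable_toTrajMod : Measurable (toTrajMod : (ℤ → V) → TrajMod G) := by
  classical
  have hproj : Measurable fun w : trajSet G => proj (G := G) ⟨w.1, w.2⟩ :=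
    measurable_proj.comp measurable_subtype_coe.subtype_mk
  exact Measurable.dite hproj measurable_const (measurableSet_trajSet G)

lemma map_proj_comap_val (μ : Measure (ℤ → V)) :
    (μ.comap (Subtype.val : Traj G → ℤ → V)).map proj =
      (μ.restrict (trajSet G)).map toTrajMod := by
  have hval : MeasurableEmbedding (Subtype.val : Traj G → ℤ → V) :=
    MeasurableEmbedding.subtype_coe (measurableSet_trajSet G)
  have hrange : Set.range (Subtype.val : Traj G → ℤ → V) = trajSet G := Subtype.range_val
  have hproj : proj = toTrajMod ∘ (Subtype.val : Traj G → ℤ → V) :=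
    funext fun w => (toTrajMod_of_mem w.2).symm
  rw [← hrange, ← hval.map_comap, Measure.map_map measurable_toTrajMod hval.measurable, ← hproj]

end TrajectoriesModuloShift

/-! ### Density of the far trajectories -/

section Density

variable {V : Type*} [MeasurableSpace V] [DiscreteMeasurableSpace V] {G : SimpleGraph V}
  [G.LocallyFinite] {a : V → V → ℝ≥0}

lemma walkLaw_eq_pathKernel (x : V) : walkLaw G a x = pathKernel (step G a) x := rfl

lemma equilibrium_smul_cond_prod_map_glue (K : Finset V) (x : V) :
    equilibrium G a K x •
        ((cond (walkLaw G a x) (noReturn K)).prod (walkLaw G a x)).map glue =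
      (totalWeight G a x : ℝ≥0∞) •
        (twoSidedLaw (step G a) x).restrict {w | ∀ n < 0, w n ∉ K} := by
  simp only [equilibrium, walkLaw_eq_pathKernel]
  set μ := pathKernel (step G a) x
  have hrestrict : (twoSidedLaw (step G a) x).restrict {w | ∀ n < 0, w n ∉ K} =
      ((μ.restrict (noReturn K)).prod μ).map glue := by
    rw [twoSidedLaw, Measure.restrict_map (s := {w : ℤ → V | ∀ n < 0, w n ∉ K}) measurable_glue
      (measurableSet_forall_lt_zero_notMem (K : Set V)), preimage_glue_forall_lt_zero,
      ← Measure.prod_restrict, Measure.restrict_univ]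
  rw [hrestrict, ProbabilityTheory.cond, Measure.prod_smul_left, Measure.map_smul, smul_smul,
    mul_assoc]
  by_cases h0 : μ (noReturn K) = 0
  · simp [Measure.restrict_eq_zero.2 h0]
  · rw [ENNReal.mul_inv_cancel h0 (measure_ne_top _ _), mul_one]

variable [Countable V]

namespace IsTransient

variable (htrans : IsTransient G a)
include htrans

lemma ae_mem_trajSet (x : V) : ∀ᵐ w ∂twoSidedLaw (step G a) x, w ∈ trajSet G := by
  refine (ae_map_iff measurable_glue.aemeasurable (measurableSet_trajSet G)).2 ?_
  filter_upwards [ae_prod_pathKernel (step G a) ((ae_pathKernel_zero (step G a) x).and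
    (htrans.ae_mem_transientRays x))] with p hp
  exact glue_mem_trajSet (hp.1.1.trans hp.2.1.symm) hp.1.2 hp.2.2

lemma nuOn_map_proj [Nonempty (TrajMod G)] (K : Finset V) :
    (nuOn G a K).map proj = (∑ x ∈ K, (totalWeight G a x : ℝ≥0∞) •
      (twoSidedLaw (step G a) x).restrict {w | ∀ n < 0, w n ∉ K}).map toTrajMod := by
  simp_rw [nuOn, map_proj_comap_val, equilibrium_smul_cond_prod_map_glue]
  rw [Measure.restrict_eq_self_of_ae_mem]
  exact ae_finsetSum_measure_iff.2 fun x _ =>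
    Measure.ae_smul_measure (ae_restrict_of_ae (htrans.ae_mem_trajSet x)) _

end IsTransient

variable (G a) in
/-- An upper bound for the density of `mixLaw` with respect to the intensity measure. -/
def mixDensity (o : V) (n : ℕ) (c : TrajMod G) : ℝ≥0∞ :=
  ∑' u, transProb (step G a) n u o / totalWeight G a o * visits u c

lemma measurable_mixDensity (o : V) (n : ℕ) : Measurable (mixDensity G a o n) :=
  Measurable.tsum fun u => (measurable_visits u).const_mul _

variable [Nonempty (TrajMod G)]

variable (G a) in
/-- The law, modulo time shift, of the two-sided chain started at `x`. -/
def classLaw : Kernel V (TrajMod G) where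
  toFun x := (twoSidedLaw (step G a) x).map toTrajMod
  measurable' := Measurable.of_discrete

instance : IsMarkovKernel (classLaw G a) :=
  ⟨fun _ => Measure.isProbabilityMeasure_map measurable_toTrajMod.aemeasurable⟩

variable (G a) in
/-- The law of the trajectory `classLaw` started at the position at time `n` of the chain
started at `o`. -/
def mixLaw (o : V) (n : ℕ) : Measure (TrajMod G) :=
  classLaw G a ∘ₘ (pathKernel (step G a) o).map fun b => b n

instance (o : V) (n : ℕ) : IsProbabilityMeasure (mixLaw G a o n) := by
  have : IsProbabilityMeasure ((pathKernel (step G a) o).map fun b => b n) :=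
    Measure.isProbabilityMeasure_map (measurable_pi_apply n).aemeasurable
  unfold mixLaw
  infer_instance

lemma lintegral_mixLaw (o : V) (n : ℕ) {f : TrajMod G → ℝ≥0∞} (hf : Measurable f) :
    ∫⁻ c, f c ∂mixLaw G a o n =
      ∑' u, transProb (step G a) n o u * ∫⁻ c, f c ∂classLaw G a u := by
  rw [mixLaw, Measure.lintegral_bind (classLaw G a).aemeasurable hf.aemeasurable,
    lintegral_countable']
  refine tsum_congr fun u => ?_
  rw [mul_comm, Measure.map_apply (measurable_pi_apply n) (measurableSet_singleton u)]
  rfl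

lemma mixLaw_apply (o : V) (n : ℕ) {D : Set (TrajMod G)} (hD : MeasurableSet D) :
    mixLaw G a o n D = ∑' u, transProb (step G a) n o u * classLaw G a u D := by
  simpa only [lintegral_indicator_one hD] using
    lintegral_mixLaw (a := a) o n (measurable_one.indicator hD)

namespace IsTransient

variable (htrans : IsTransient G a)
include htrans

lemma nu_absolutelyContinuous : nu G a ≪ Measure.sum (classLaw G a) := by
  refine Measure.AbsolutelyContinuous.trans (Measure.absolutelyContinuous_of_le
    (iSup_le fun K : Finset V => Measure.le_sum (fun K => (nuOn G a K).map proj) K))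
    (Measure.absolutelyContinuous_sum_left fun K =>
      Measure.AbsolutelyContinuous.mk fun D hD h0 => ?_)
  have hnull (x : V) : twoSidedLaw (step G a) x (toTrajMod ⁻¹' D) = 0 := by
    rw [← Measure.map_apply measurable_toTrajMod hD]
    exact (Measure.sum_apply_eq_zero' hD).1 h0 x
  rw [htrans.nuOn_map_proj, Measure.map_apply measurable_toTrajMod hD, Measure.finsetSum_apply]
  exact Finset.sum_eq_zero fun x _ => mul_eq_zero_of_right _
    (Measure.absolutelyContinuous_of_le Measure.restrict_le_self (hnull x))

lemma lintegral_visits_classLaw_le (u v : V) :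
    ∫⁻ c, visits u c ∂classLaw G a v ≤ 2 * green (step G a) v u := by
  calc ∫⁻ c, visits u c ∂classLaw G a v
      = ∫⁻ w, visitCount u w ∂twoSidedLaw (step G a) v := by
        refine (lintegral_map (measurable_visits u) measurable_toTrajMod).trans ?_
        exact lintegral_congr_ae ((htrans.ae_mem_trajSet v).mono fun w hw => visits_toTrajMod hw u)
    _ ≤ 2 * green (step G a) v u := lintegral_visitCount_le (step G a) u v

lemma lintegral_mixDensity_le (o : V) (n : ℕ) :
    ∫⁻ c, mixDensity G a o n c ∂mixLaw G a o n ≤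
      2 / totalWeight G a o * ∑' k, transProb (step G a) (k + 2 * n) o o := by
  have hinner (v : V) : ∫⁻ c, mixDensity G a o n c ∂classLaw G a v ≤
      2 / totalWeight G a o * ∑' k, transProb (step G a) (k + n) v o :=
    calc ∫⁻ c, mixDensity G a o n c ∂classLaw G a v
        = ∑' u, transProb (step G a) n u o / totalWeight G a o *
            ∫⁻ c, visits u c ∂classLaw G a v := by
          simp only [mixDensity]
          rw [lintegral_tsum fun u => ((measurable_visits u).const_mul _).aemeasurable]
          simp only [lintegral_const_mul _ (measurable_visits _)]
      _ ≤ ∑' u, transProb (step G a) n u o / totalWeight G a o * (2 * green (step G a) v u) := by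
          gcongr with u
          exact htrans.lintegral_visits_classLaw_le u v
      _ = 2 / totalWeight G a o * ∑' u, ∑' k,
            transProb (step G a) k v u * transProb (step G a) n u o := by
          rw [← ENNReal.tsum_mul_left]
          refine tsum_congr fun u => ?_
          rw [ENNReal.tsum_mul_right, green]
          simp only [div_eq_mul_inv]
          ring
      _ = 2 / totalWeight G a o * ∑' k, transProb (step G a) (k + n) v o := by
          rw [ENNReal.tsum_comm]
          simp only [chapman_kolmogorov]
  calc ∫⁻ c, mixDensity G a o n c ∂mixLaw G a o n
      = ∑' v, transProb (step G a) n o v * ∫⁻ c, mixDensity G a o n c ∂classLaw G a v :=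
        lintegral_mixLaw o n (measurable_mixDensity o n)
    _ ≤ ∑' v, transProb (step G a) n o v *
          (2 / totalWeight G a o * ∑' k, transProb (step G a) (k + n) v o) := by
        gcongr with v
        exact hinner v
    _ = 2 / totalWeight G a o * ∑' k, ∑' v,
          transProb (step G a) n o v * transProb (step G a) (k + n) v o := by
        rw [ENNReal.tsum_comm, ← ENNReal.tsum_mul_left]
        refine tsum_congr fun v => ?_
        rw [ENNReal.tsum_mul_left, mul_left_comm]
    _ = 2 / totalWeight G a o * ∑' k, transProb (step G a) (k + 2 * n) o o := by
        simp only [← chapman_kolmogorov, two_mul, add_left_comm n]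

lemma tendsto_lintegral_mixDensity (o : V) :
    Filter.Tendsto (fun n => ∫⁻ c, mixDensity G a o n c ∂mixLaw G a o n)
      Filter.atTop (nhds 0) := by
  have htail := (ENNReal.tendsto_sum_nat_add (fun k => transProb (step G a) k o o)
    (htrans.green_self_ne_top o)).comp (Filter.tendsto_id.const_mul_atTop' (two_pos : 0 < 2))
  have hlim := ENNReal.Tendsto.const_mul htail
    (Or.inr (ENNReal.div_ne_top (x := 2) (by simp) (htrans.totalWeight_ne_zero o)))
  rw [mul_zero] at hlim
  exact tendsto_of_tendsto_of_tendsto_of_le_of_le tendsto_const_nhds hlim (fun _ => zero_le)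
    (htrans.lintegral_mixDensity_le o)

variable (ha_symm : ∀ x y, a x y = a y x)
include ha_symm

lemma smul_classLaw (u : V) : (totalWeight G a u : ℝ≥0∞) • classLaw G a u =
    ((nuOn G a {u}).map proj).withDensity (visits u) := by
  ext D hD
  set N : Set (ℤ → V) := {w | ∀ n < 0, w n ≠ u} with hN
  set B : Set (ℤ → V) := toTrajMod ⁻¹' D ∩ trajSet G with hB
  have hDm : MeasurableSet ((toTrajMod : (ℤ → V) → TrajMod G) ⁻¹' D) := measurable_toTrajMod hD
  have hBm : MeasurableSet B := hDm.inter (measurableSet_trajSet G)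
  have hNm : MeasurableSet N := measurableSet_forall_lt_zero_notMem {u}
  have hBshift (n : ℕ) : shiftZ n ⁻¹' B = B := by
    ext w
    simp only [hB, Set.mem_preimage, Set.mem_inter_iff, toTrajMod_shiftZ, shiftZ_mem_trajSet_iff]
  have hBae : B =ᵐ[twoSidedLaw (step G a) u] toTrajMod ⁻¹' D :=
    inter_ae_eq_left_of_ae_eq_univ (Filter.eventuallyEq_univ.2 (htrans.ae_mem_trajSet u))
  calc (totalWeight G a u • classLaw G a u) D
      = totalWeight G a u * twoSidedLaw (step G a) u B := by
        rw [measure_congr hBae, ← Measure.map_apply measurable_toTrajMod hD]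
        rfl
    _ = totalWeight G a u * ∫⁻ w in B ∩ N, visitCount u w ∂twoSidedLaw (step G a) u :=
        mul_twoSidedLaw_eq_lintegral_visitCount (m := fun x => (totalWeight G a x : ℝ≥0∞))
          (totalWeight_mul_step_comm ha_symm) hBm hBshift fun w hw => hw.2.2 u
    _ = totalWeight G a u * ∫⁻ w in B ∩ N, visits u (toTrajMod w : TrajMod G)
          ∂twoSidedLaw (step G a) u := by
        rw [setLIntegral_congr_fun (hBm.inter hNm) fun w hw => visits_toTrajMod hw.1.2 u]
    _ = ((nuOn G a {u}).map proj).withDensity (visits u) D := by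
        rw [withDensity_apply _ hD, htrans.nuOn_map_proj, Finset.sum_singleton]
        simp only [Finset.mem_singleton]
        rw [setLIntegral_map hD (measurable_visits u) measurable_toTrajMod, Measure.restrict_smul,
          lintegral_smul_measure, Measure.restrict_restrict hDm, ← hN,
          Measure.restrict_congr_set (hBae.inter (ae_eq_refl N))]
        rfl

lemma mixLaw_le (o : V) (n : ℕ) :
    mixLaw G a o n ≤ (nu G a).withDensity (mixDensity G a o n) := by
  refine Measure.le_iff.2 fun D hD => ?_
  have ho : (totalWeight G a o : ℝ≥0∞) ≠ 0 := htrans.totalWeight_ne_zero o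
  have hrev (u : V) : transProb (step G a) n o u =
      transProb (step G a) n u o / totalWeight G a o * totalWeight G a u := by
    rw [← ENNReal.mul_div_right_comm, ENNReal.eq_div_iff ho ENNReal.coe_ne_top,
      mul_comm (transProb _ _ u o)]
    exact mul_transProb_comm (m := fun x => (totalWeight G a x : ℝ≥0∞))
      (totalWeight_mul_step_comm ha_symm) n o u
  calc mixLaw G a o n D
      = ∑' u, transProb (step G a) n u o / totalWeight G a o *
          (totalWeight G a u * classLaw G a u D) := by
        rw [mixLaw_apply o n hD]
        exact tsum_congr fun u => by rw [hrev, mul_assoc]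
    _ = ∑' u, transProb (step G a) n u o / totalWeight G a o *
          ∫⁻ c in D, visits u c ∂(nuOn G a {u}).map proj :=
        tsum_congr fun u => by
          rw [← withDensity_apply _ hD, ← htrans.smul_classLaw ha_symm]
          rfl
    _ ≤ ∑' u, transProb (step G a) n u o / totalWeight G a o * ∫⁻ c in D, visits u c ∂nu G a := by
        gcongr with u
        exact le_iSup (fun K => (nuOn G a K).map proj) {u}
    _ = (nu G a).withDensity (mixDensity G a o n) D := by
        simp only [withDensity_apply _ hD, mixDensity]
        rw [lintegral_tsum fun u => ((measurable_visits u).const_mul _).aemeasurable]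
        simp only [lintegral_const_mul _ (measurable_visits _)]

end IsTransient

end Density

/-! ### Unpaired pieces -/

section Pieces

variable {V : Type*} {G : SimpleGraph V} {K : Finset V}

/-- The trajectory run backwards in time. It exchanges first and last visits, and so reduces
statements about outgoing pieces to statements about incoming ones. -/
def timeReversal (w : Traj G) : Traj G :=
  ⟨fun n => w.1 (-n), fun n => by simpa [neg_add] using (w.2.1 (-(n + 1))).symm,
    fun x => (w.2.2 x).preimage neg_injective.injOn⟩

lemma isLeast_hitTime {w : Traj G} (h : Hits K w) : IsLeast {n : ℤ | w.1 n ∈ K} (hitTime K w) :=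
  ⟨Int.csInf_mem h (visits_finite K w).bddBelow,
    fun _ hn => csInf_le (visits_finite K w).bddBelow hn⟩

lemma hitTime_eq_zero_of_not_hits {w : Traj G} (h : ¬ Hits K w) : hitTime K w = 0 := by
  have hempty : {n : ℤ | w.1 n ∈ K} = ∅ := Set.eq_empty_of_forall_notMem fun n hn => h ⟨n, hn⟩
  rw [hitTime, hempty, Int.csInf_empty]

lemma lastTime_eq_neg_hitTime (w : Traj G) : lastTime K w = -hitTime K (timeReversal w) := by
  have hneg : {n : ℤ | (timeReversal w).1 n ∈ K} = -{n : ℤ | w.1 n ∈ K} := rfl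
  rcases {n : ℤ | w.1 n ∈ K}.eq_empty_or_nonempty with h | h
  · rw [lastTime, hitTime, hneg, h, Set.neg_empty, Int.csSup_empty, Int.csInf_empty, neg_zero]
  · rw [lastTime, hitTime, hneg, csInf_neg h (visits_finite K w).bddAbove, neg_neg]

lemma outOut_eq_outIn_timeReversal (w : Traj G) : outOut K w = outIn K (timeReversal w) := by
  funext n
  rw [outOut, outIn, lastTime_eq_neg_hitTime]
  exact congrArg w.1 (by ring)

lemma outIn_eq_of_past_eq {w w' : Traj G} (k : ℤ) (h0 : w'.1 0 ∈ K)
    (h : ∀ j : ℕ, w.1 (-j - k) = w'.1 (-j)) : Hits K w ∧ outIn K w = outIn K w' := by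
  have hpast (n : ℤ) (hn : n ≤ 0) : w.1 (n - k) = w'.1 n := by
    obtain ⟨j, hj⟩ := Int.eq_ofNat_of_zero_le (neg_nonneg.2 hn)
    obtain rfl : n = -(j : ℤ) := by omega
    exact h j
  have hleast := isLeast_hitTime (w := w') ⟨0, h0⟩
  have hnonpos : hitTime K w' ≤ 0 := hleast.2 h0
  have hvisit : w.1 (hitTime K w' - k) ∈ K := hpast _ hnonpos ▸ hleast.1
  have hshift : hitTime K w = hitTime K w' - k := by
    refine IsLeast.csInf_eq ⟨hvisit, fun n hn => ?_⟩
    by_contra! hlt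
    have hn' : w'.1 (n + k) ∈ K := by
      rw [← hpast _ (by omega), add_sub_cancel_right]
      exact hn
    have := hleast.2 hn'
    omega
  refine ⟨⟨_, hvisit⟩, funext fun j => ?_⟩
  rw [outIn, outIn, hshift, ← hpast _ (by omega)]
  exact congrArg w.1 (by ring)

lemma outOut_eq_of_future_eq {w w' : Traj G} (k : ℤ) (h0 : w'.1 0 ∈ K)
    (h : ∀ j : ℕ, w.1 (j + k) = w'.1 j) : outOut K w = outOut K w' := by
  rw [outOut_eq_outIn_timeReversal, outOut_eq_outIn_timeReversal]
  refine (outIn_eq_of_past_eq (w := timeReversal w) (w' := timeReversal w') k h0 fun j => ?_).2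
  change w.1 (-(-j - k)) = w'.1 (-(-j))
  rw [neg_neg, ← h j]
  exact congrArg w.1 (by ring)

variable [MeasurableSpace V]

lemma tracePieces_of_hits {w : Traj G} (h : Hits K w) : tracePieces K w =
    Measure.dirac (Sum.inl (outIn K w)) + Measure.dirac (Sum.inr (Sum.inl (outOut K w))) :=
  if_pos h

/-- As `K` contains the positions of `p` and `p'` at times `±n`, it hides what happens in between;
the incoming and outgoing ends that are left do not record how they were joined. -/
lemma tracePieces_add_eq_of_exchange {n : ℕ} {p p' q q' : (ℕ → V) × (ℕ → V)} {w w' v v' : Traj G}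
    (hw : w.1 = glue p) (hw' : w'.1 = glue p') (hv : v.1 = glue q) (hv' : v'.1 = glue q')
    (hp : p.1 0 = p.2 0) (hp' : p'.1 0 = p'.2 0) (hq : q.1 0 = q.2 0) (hq' : q'.1 0 = q'.2 0)
    (hpq : shiftPath n p.1 = q.1 ∧ shiftPath n p.2 = q'.2)
    (hpq' : shiftPath n p'.1 = q'.1 ∧ shiftPath n p'.2 = q.2)
    (hqK : q.1 0 ∈ K) (hqK' : q'.1 0 ∈ K) :
    tracePieces K w + tracePieces K w' = tracePieces K v + tracePieces K v' := by
  have hv0 : v.1 0 ∈ K := by rwa [hv, glue_zero]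
  have hv0' : v'.1 0 ∈ K := by rwa [hv', glue_zero]
  have hneg (j : ℕ) : -(j : ℤ) - n = -((n + j : ℕ) : ℤ) := by push_cast; ring
  have hpos (j : ℕ) : (j : ℤ) + n = ((n + j : ℕ) : ℤ) := by push_cast; ring
  obtain ⟨hits, hin⟩ := outIn_eq_of_past_eq (w := w) (w' := v) n hv0 fun j => by
    rw [hw, hv, hneg, glue_neg, glue_neg, ← hpq.1, shiftPath]
  obtain ⟨hits', hin'⟩ := outIn_eq_of_past_eq (w := w') (w' := v') n hv0' fun j => by
    rw [hw', hv', hneg, glue_neg, glue_neg, ← hpq'.1, shiftPath]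
  have hout := outOut_eq_of_future_eq (w := w) (w' := v') n hv0' fun j => by
    rw [hw, hv', hpos, glue_natCast hp, glue_natCast hq', ← hpq.2, shiftPath]
  have hout' := outOut_eq_of_future_eq (w := w') (w' := v) n hv0 fun j => by
    rw [hw', hv, hpos, glue_natCast hp', glue_natCast hq, ← hpq'.2, shiftPath]
  rw [tracePieces_of_hits hits, tracePieces_of_hits hits', tracePieces_of_hits ⟨0, hv0⟩,
    tracePieces_of_hits ⟨0, hv0'⟩, hin, hin', hout, hout']
  abel

end Pieces

section TraceMeasurability

variable {V : Type*} {G : SimpleGraph V} [MeasurableSpace V]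

lemma measurable_timeReversal : Measurable (timeReversal (G := G)) := by
  have h : Measurable fun (w : Traj G) (n : ℤ) => w.1 (-n) :=
    measurable_pi_iff.2 fun n => (measurable_pi_apply (-n)).comp measurable_subtype_coe
  exact h.subtype_mk

variable [DiscreteMeasurableSpace V] (K : Finset V)

lemma measurable_hitTime : Measurable (hitTime (G := G) K) := by
  refine measurable_to_countable' fun n => ?_
  have hpreimage : hitTime (G := G) K ⁻¹' {n} =
      ({w | w.1 n ∈ K} ∩ ⋂ m : Set.Iio n, {w | w.1 m ∈ K}ᶜ) ∪
        ({w | Hits K w}ᶜ ∩ {_w | n = 0}) := by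
    ext w
    simp only [Set.mem_preimage, Set.mem_singleton_iff, Set.mem_union, Set.mem_inter_iff,
      Set.mem_ofPred_eq, Set.mem_iInter, Set.mem_compl_iff, Subtype.forall, Set.mem_Iio]
    constructor
    · rintro rfl
      by_cases h : Hits K w
      · exact Or.inl ⟨(isLeast_hitTime h).1, fun m hm hmK => hm.not_ge ((isLeast_hitTime h).2 hmK)⟩
      · exact Or.inr ⟨h, hitTime_eq_zero_of_not_hits h⟩
    · rintro (⟨hn, hlt⟩ | ⟨h, rfl⟩)
      · exact (isLeast_hitTime ⟨n, hn⟩).unique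
          ⟨hn, fun m hm => not_lt.1 fun hmn => hlt m hmn hm⟩
      · exact hitTime_eq_zero_of_not_hits h
  rw [hpreimage]
  exact ((measurableSet_apply_mem K n).inter (MeasurableSet.iInter fun m : Set.Iio n =>
    (measurableSet_apply_mem K (m : ℤ)).compl)).union
    ((measurableSet_hits K).compl.inter (MeasurableSet.const _))

lemma measurable_outIn : Measurable (outIn (G := G) K) := by
  have heval : Measurable fun q : Traj G × ℤ => q.1.1 q.2 :=
    measurable_from_prod_countable_left fun n =>
      (measurable_pi_apply n).comp measurable_subtype_coe
  exact measurable_pi_iff.2 fun j =>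
    heval.comp (measurable_id.prodMk ((measurable_hitTime K).sub_const (j : ℤ)))

lemma measurable_outOut : Measurable (outOut (G := G) K) := by
  rw [funext outOut_eq_outIn_timeReversal]
  exact (measurable_outIn K).comp measurable_timeReversal

lemma measurable_tracePiecesMod : Measurable (tracePiecesMod (G := G) K) := by
  refine measurable_from_quotient.2 (?_ : Measurable (tracePieces (G := G) K))
  unfold tracePieces
  refine Measurable.ite (measurableSet_hits K) ?_ ?_
  · exact (Measure.measurable_dirac.comp (measurable_inl.comp (measurable_outIn K))).add
      (Measure.measurable_dirac.comp
        (measurable_inr.comp (measurable_inl.comp (measurable_outOut K))))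
  · exact Measure.measurable_dirac.comp (measurable_inr.comp (measurable_inr.comp measurable_proj))

lemma measurable_outUnpaired : Measurable (outUnpaired (G := G) K) :=
  (Measure.measurable_bind' (measurable_tracePiecesMod K)).comp measurable_subtype_coe

end TraceMeasurability

section AddTraj

lemma exists_sum_dirac_eq {ι X : Type*} [Countable ι] [MeasurableSpace X] (f : ι → X) :
    ∃ (I : Set ℕ) (g : I → X),
      Measure.sum (fun i => Measure.dirac (f i)) = Measure.sum fun i => Measure.dirac (g i) := by
  obtain ⟨e, he⟩ := exists_injective_nat ι
  let e' : Set.range e ≃ ι := (Equiv.ofInjective e he).symm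
  exact ⟨Set.range e, f ∘ e', (Measure.sum_comp_equiv e' fun i => Measure.dirac (f i)).symm⟩

variable {V : Type*} {G : SimpleGraph V} [MeasurableSpace V]

/-- The configuration `ω` with one more trajectory. -/
def addTraj (ω : Config G) (c : TrajMod G) : Config G where
  val := ω.1 + Measure.dirac c
  property := by
    obtain ⟨I, f, hf⟩ := ω.2.1
    obtain ⟨J, g, hg⟩ := exists_sum_dirac_eq (Sum.elim f fun _ : Unit => c)
    refine ⟨⟨J, g, hg ▸ Measure.ext fun D hD => ?_⟩, fun K => ?_⟩
    · rw [Measure.sum_apply _ hD, hf, Measure.add_apply, Measure.sum_apply _ hD,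
        ENNReal.summable.tsum_sum ENNReal.summable]
      simp
    · exact ENNReal.add_lt_top.2 ⟨ω.2.2 K, prob_le_one.trans_lt ENNReal.one_lt_top⟩

lemma le_addTraj (ω : Config G) (c : TrajMod G) : ω ≤ addTraj ω c :=
  show ω.1 ≤ ω.1 + Measure.dirac c from Measure.le_add_right le_rfl

lemma mem_iff_of_outUnpaired_eq {E : Set (Config G)} (hE : MeasurableSet[unpairedTail G] E)
    (K : Finset V) {ω ω' : Config G} (h : outUnpaired K ω = outUnpaired K ω') :
    ω ∈ E ↔ ω' ∈ E := by
  obtain ⟨T, -, rfl⟩ := iInf_le (fun K : Finset V =>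
    MeasurableSpace.comap (outUnpaired (G := G) K) inferInstance) K E hE
  rw [Set.mem_preimage, Set.mem_preimage, h]

variable [DiscreteMeasurableSpace V]

lemma outUnpaired_addTraj (K : Finset V) (ω : Config G) (c : TrajMod G) :
    outUnpaired K (addTraj ω c) = outUnpaired K ω + tracePiecesMod K c := by
  have hm := measurable_tracePiecesMod (G := G) K
  have hbind : (Measure.dirac c).bind (tracePiecesMod K) = tracePiecesMod K c :=
    Measure.dirac_bind hm c
  rw [← hbind]
  exact Measure.ext fun D hD => by
    rw [outUnpaired, outUnpaired, Measure.add_apply, Measure.bind_apply hD hm.aemeasurable,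
      Measure.bind_apply hD hm.aemeasurable, Measure.bind_apply hD hm.aemeasurable, addTraj,
      lintegral_add_measure]

lemma measurableSet_of_unpairedTail {E : Set (Config G)} (hE : MeasurableSet[unpairedTail G] E) :
    MeasurableSet E :=
  (measurable_outUnpaired ∅).comap_le E
    (iInf_le (fun K : Finset V => MeasurableSpace.comap (outUnpaired (G := G) K) inferInstance) ∅
      E hE)

end AddTraj

/-! ### The zero-one law -/

section Fork

variable {V : Type*} [MeasurableSpace V] (κ : Kernel V V) [IsMarkovKernel κ]

/-- The joint law of the chain started at `x` and of two chains that continue it independently of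
each other from time `n` on. -/
def forkLaw (x : V) (n : ℕ) : Measure ((ℕ → V) × (ℕ → V) × (ℕ → V)) :=
  pathKernel κ x ⊗ₘ ((pathKernel κ).comap (fun b => b n) (measurable_pi_apply n) ×ₖ
    (pathKernel κ).comap (fun b => b n) (measurable_pi_apply n))

instance (x : V) (n : ℕ) : IsProbabilityMeasure (forkLaw κ x n) := by
  unfold forkLaw
  infer_instance

variable [DiscreteMeasurableSpace V] [Countable V]

lemma map_splice_fst_forkLaw (x : V) (n : ℕ) :
    (forkLaw κ x n).map (fun q => splice n q.1 q.2.1) = pathKernel κ x := by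
  have hfst : (forkLaw κ x n).map (Prod.map id Prod.fst) =
      pathKernel κ x ⊗ₘ (pathKernel κ).comap (fun b => b n) (measurable_pi_apply n) := by
    rw [forkLaw, ← Measure.compProd_map measurable_fst, ← Kernel.fst_eq, Kernel.fst_prod]
  rw [← markov_property κ n x, ← hfst, Measure.map_map (measurable_splice n) (by fun_prop)]
  rfl

lemma map_splice_snd_forkLaw (x : V) (n : ℕ) :
    (forkLaw κ x n).map (fun q => splice n q.1 q.2.2) = pathKernel κ x := by
  have hsnd : (forkLaw κ x n).map (Prod.map id Prod.snd) =
      pathKernel κ x ⊗ₘ (pathKernel κ).comap (fun b => b n) (measurable_pi_apply n) := by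
    rw [forkLaw, ← Measure.compProd_map measurable_snd, ← Kernel.snd_eq, Kernel.snd_prod]
  rw [← markov_property κ n x, ← hsnd, Measure.map_map (measurable_splice n) (by fun_prop)]
  rfl

lemma ae_forkLaw_splice {x : V} {Q : (ℕ → V) → Prop} (h : ∀ᵐ w ∂pathKernel κ x, Q w) (n : ℕ) :
    ∀ᵐ q ∂forkLaw κ x n, Q (splice n q.1 q.2.1) ∧ Q (splice n q.1 q.2.2) :=
  (ae_of_ae_map (by fun_prop) ((map_splice_fst_forkLaw κ x n).symm ▸ h)).and
    (ae_of_ae_map (by fun_prop) ((map_splice_snd_forkLaw κ x n).symm ▸ h))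

lemma ae_forkLaw_zero_eq (x : V) (n : ℕ) :
    ∀ᵐ q ∂forkLaw κ x n, q.2.1 0 = q.2.2 0 := by
  refine Measure.ae_compProd_of_ae_ae (measurableSet_eq_fun (by fun_prop) (by fun_prop))
    (ae_of_all _ fun b => ?_)
  rw [Kernel.prod_apply, Kernel.comap_apply]
  filter_upwards [ae_prod_pathKernel κ (ae_pathKernel_zero κ (b n))] with p hp
  exact hp.1.trans hp.2.symm

end Fork

section Coupling

variable {V : Type*} [MeasurableSpace V] [DiscreteMeasurableSpace V] [Countable V]
  {G : SimpleGraph V} [G.LocallyFinite] {a : V → V → ℝ≥0} [Nonempty (TrajMod G)]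

lemma map_splice_prod_forkLaw (o : V) (n : ℕ) :
    ((forkLaw (step G a) o n).prod (forkLaw (step G a) o n)).map
        (fun r => toTrajMod (glue (splice n r.1.1 r.1.2.1, splice n r.2.1 r.2.2.2))) =
      classLaw G a o := by
  have hpair : ((forkLaw (step G a) o n).prod (forkLaw (step G a) o n)).map
      (Prod.map (fun q => splice n q.1 q.2.1) fun q => splice n q.1 q.2.2) =
      (pathKernel (step G a) o).prod (pathKernel (step G a) o) := by
    rw [← Measure.map_prod_map _ _ (by fun_prop) (by fun_prop), map_splice_fst_forkLaw,
      map_splice_snd_forkLaw]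
  change _ = (twoSidedLaw (step G a) o).map toTrajMod
  rw [twoSidedLaw, ← hpair, Measure.map_map measurable_glue (by fun_prop),
    Measure.map_map measurable_toTrajMod (by fun_prop)]
  rfl

lemma map_snd_forkLaw (o : V) (n : ℕ) :
    (forkLaw (step G a) o n).map (fun q => toTrajMod (glue q.2)) = mixLaw G a o n := by
  have hm : Measurable fun q : (ℕ → V) × (ℕ → V) × (ℕ → V) =>
      (toTrajMod (glue q.2) : TrajMod G) := by fun_prop
  refine Measure.ext_of_lintegral _ fun f hf => ?_
  rw [lintegral_map hf hm, forkLaw, Measure.lintegral_compProd (by fun_prop), mixLaw,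
    Measure.lintegral_bind (classLaw G a).aemeasurable hf.aemeasurable,
    lintegral_map hf.lintegral_kernel (measurable_pi_apply n)]
  refine lintegral_congr fun b => ?_
  rw [Kernel.prod_apply, Kernel.comap_apply]
  change _ = ∫⁻ c, f c ∂(twoSidedLaw (step G a) (b n)).map toTrajMod
  rw [lintegral_map hf measurable_toTrajMod,
    twoSidedLaw, lintegral_map (f := fun w => f (toTrajMod w)) (by fun_prop) measurable_glue]

lemma IsTransient.ae_forkLaw_exchange (htrans : IsTransient G a) (o : V) (n : ℕ) :
    ∀ᵐ r ∂(forkLaw (step G a) o n).prod (forkLaw (step G a) o n),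
      ∃ (K : Finset V) (c : TrajMod G),
        tracePiecesMod K (toTrajMod (glue (splice n r.1.1 r.1.2.1, splice n r.2.1 r.2.2.2))) +
            tracePiecesMod K c =
          tracePiecesMod K (toTrajMod (glue r.1.2)) +
            tracePiecesMod K (toTrajMod (glue r.2.2)) := by
  classical
  have hfork := (ae_forkLaw_splice (step G a) ((ae_pathKernel_zero (step G a) o).and
    (htrans.ae_mem_transientRays o)) n).and (ae_forkLaw_zero_eq (step G a) o n)
  filter_upwards [Measure.quasiMeasurePreserving_fst.ae hfork,
    Measure.quasiMeasurePreserving_snd.ae hfork] with ⟨⟨b, α, α'⟩, ⟨c, β', β⟩⟩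
    ⟨⟨⟨hbα0, hbα⟩, ⟨hbα0', hbα'⟩⟩, hα0⟩ ⟨⟨⟨hcβ0', hcβ'⟩, ⟨hcβ0, hcβ⟩⟩, hβ0⟩
  have hα := shiftPath_mem_transientRays hbα n
  have hα' := shiftPath_mem_transientRays hbα' n
  have hβ := shiftPath_mem_transientRays hcβ n
  have hβ' := shiftPath_mem_transientRays hcβ' n
  rw [shiftPath_splice] at hα hα' hβ hβ'
  have hcross := glue_mem_trajSet (p := (splice n b α, splice n c β)) (hbα0.trans hcβ0.symm) hbα hcβ
  have hcross' := glue_mem_trajSet (p := (splice n c β', splice n b α'))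
    (hcβ0'.trans hbα0'.symm) hcβ' hbα'
  have hfar := glue_mem_trajSet (p := (α, α')) hα0 hα hα'
  have hfar' := glue_mem_trajSet (p := (β', β)) hβ0 hβ' hβ
  refine ⟨{α 0, β' 0}, proj ⟨_, hcross'⟩, ?_⟩
  rw [toTrajMod_of_mem hcross, toTrajMod_of_mem hfar, toTrajMod_of_mem hfar']
  exact tracePieces_add_eq_of_exchange (w := ⟨_, hcross⟩) (w' := ⟨_, hcross'⟩) (v := ⟨_, hfar⟩)
    (v' := ⟨_, hfar'⟩) rfl rfl rfl rfl (hbα0.trans hcβ0.symm) (hcβ0'.trans hbα0'.symm) hα0 hβ0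
    ⟨shiftPath_splice n b α, shiftPath_splice n c β⟩
    ⟨shiftPath_splice n c β', shiftPath_splice n b α'⟩ (by simp) (by simp)

end Coupling

section ZeroOne

variable {V : Type*} [MeasurableSpace V] [DiscreteMeasurableSpace V]
  {G : SimpleGraph V}

lemma addTraj_addTraj_mem_of_exchange {E : Set (Config G)} (hE : MeasurableSet[unpairedTail G] E)
    (hE_incr : IsUpperSet E) {K : Finset V} {c c' d d' : TrajMod G}
    (h : tracePiecesMod K c + tracePiecesMod K c' = tracePiecesMod K d + tracePiecesMod K d')
    {ω : Config G} (hc : addTraj ω c ∈ E) : addTraj (addTraj ω d) d' ∈ E := by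
  have hc' : addTraj (addTraj ω c) c' ∈ E := hE_incr (le_addTraj _ _) hc
  refine (mem_iff_of_outUnpaired_eq hE K ?_).1 hc'
  simp only [outUnpaired_addTraj, add_assoc, h]

variable [Countable V] [G.LocallyFinite] {a : V → V → ℝ≥0}

lemma IsInterlacementLaw.sigmaFinite {P : Measure (Config G)} (hP : IsInterlacementLaw G a P) :
    SigmaFinite (nu G a) := by
  have := hP.isProbabilityMeasure
  refine Measure.sigmaFinite_of_countable (S := Set.range fun x => hitSet G {x})
    (Set.countable_range _) ?_ (by rw [Set.sUnion_range, iUnion_hitSet_singleton])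
  rintro - ⟨x, rfl⟩
  refine lt_top_iff_ne_top.2 fun htop => ?_
  obtain ⟨ω, hω⟩ := (hP.infinite _ (measurableSet_hitSet {x}) htop).exists
  exact (ω.2.2 {x}).ne hω

variable [Nonempty (TrajMod G)] {E : Set (Measure (TrajMod G))}

lemma IsTransient.lintegral_classLaw_le (htrans : IsTransient G a) (hEm : MeasurableSet E)
    (hE : MeasurableSet[unpairedTail G] (Subtype.val ⁻¹' E : Set (Config G)))
    (hE_incr : IsUpperSet (Subtype.val ⁻¹' E : Set (Config G))) (ω : Config G) (o : V) (n : ℕ) :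
    ∫⁻ c, E.indicator 1 (ω.1 + Measure.dirac c) ∂classLaw G a o ≤
      ∫⁻ c₁, ∫⁻ c₂, E.indicator 1 (ω.1 + Measure.dirac c₁ + Measure.dirac c₂)
        ∂mixLaw G a o n ∂mixLaw G a o n := by
  set Q := forkLaw (step G a) o n
  have hind : Measurable (E.indicator (1 : Measure (TrajMod G) → ℝ≥0∞)) :=
    measurable_one.indicator hEm
  have hone : Measurable fun c : TrajMod G =>
      E.indicator (1 : Measure (TrajMod G) → ℝ≥0∞) (ω.1 + Measure.dirac c) :=
    hind.comp (measurable_const.add Measure.measurable_dirac)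
  have htwo : Measurable fun c : TrajMod G × TrajMod G =>
      E.indicator (1 : Measure (TrajMod G) → ℝ≥0∞)
        (ω.1 + Measure.dirac c.1 + Measure.dirac c.2) :=
    hind.comp ((measurable_const.add (Measure.measurable_dirac.comp measurable_fst)).add
      (Measure.measurable_dirac.comp measurable_snd))
  have hfar : Measurable fun q : (ℕ → V) × (ℕ → V) × (ℕ → V) =>
      (toTrajMod (glue q.2) : TrajMod G) := by fun_prop
  calc ∫⁻ c, E.indicator 1 (ω.1 + Measure.dirac c) ∂classLaw G a o
      = ∫⁻ r, E.indicator 1 (ω.1 + Measure.dirac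
          (toTrajMod (glue (splice n r.1.1 r.1.2.1, splice n r.2.1 r.2.2.2)))) ∂Q.prod Q := by
        rw [← map_splice_prod_forkLaw o n,
          lintegral_map hone (by fun_prop)]
    _ ≤ ∫⁻ r, E.indicator 1 (ω.1 + Measure.dirac (toTrajMod (glue r.1.2)) +
          Measure.dirac (toTrajMod (glue r.2.2))) ∂Q.prod Q := by
        refine lintegral_mono_ae ((htrans.ae_forkLaw_exchange o n).mono fun r ⟨K, c, hr⟩ => ?_)
        refine Set.indicator_apply_le' (fun hmem => ?_) fun _ => zero_le
        have hmem' : ω.1 + Measure.dirac (toTrajMod (glue r.1.2)) +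
            Measure.dirac (toTrajMod (glue r.2.2)) ∈ E :=
          addTraj_addTraj_mem_of_exchange hE hE_incr hr hmem
        exact (Set.indicator_of_mem (f := (1 : Measure (TrajMod G) → ℝ≥0∞)) hmem').ge
    _ = ∫⁻ c₁, ∫⁻ c₂, E.indicator 1 (ω.1 + Measure.dirac c₁ + Measure.dirac c₂)
          ∂mixLaw G a o n ∂mixLaw G a o n := by
        rw [← lintegral_prod (fun c : TrajMod G × TrajMod G => E.indicator 1
            (ω.1 + Measure.dirac c.1 + Measure.dirac c.2)) htwo.aemeasurable,
          ← map_snd_forkLaw, Measure.map_prod_map _ _ hfar hfar,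
          lintegral_map htwo (hfar.prodMap hfar)]
        rfl

lemma IsTransient.lintegral_classLaw_add_dirac_le (htrans : IsTransient G a)
    (ha_symm : ∀ x y, a x y = a y x) {P : Measure (Config G)} (hP : IsInterlacementLaw G a P)
    (hEm : MeasurableSet E)
    (hE : MeasurableSet[unpairedTail G] (Subtype.val ⁻¹' E : Set (Config G)))
    (hE_incr : IsUpperSet (Subtype.val ⁻¹' E : Set (Config G))) (o : V) :
    ∫⁻ c, ∫⁻ ω, E.indicator 1 (ω.1 + Measure.dirac c) ∂P ∂classLaw G a o ≤
      ∫⁻ ω, E.indicator 1 ω.1 ∂P := by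
  have := hP.isProbabilityMeasure
  have := hP.sigmaFinite
  set φ : Measure (TrajMod G) → ℝ≥0∞ := E.indicator 1
  have hφ : Measurable φ := measurable_one.indicator hEm
  set ε : ℕ → ℝ≥0∞ := fun n => (∫⁻ c, mixDensity G a o n c ∂mixLaw G a o n) ^ (1 / 2 : ℝ)
  have hε : Filter.Tendsto ε Filter.atTop (nhds 0) := by
    simpa [ε] using (htrans.tendsto_lintegral_mixDensity o).ennrpow_const (1 / 2)
  have hbound (n : ℕ) : ∫⁻ c, ∫⁻ ω, φ (ω.1 + Measure.dirac c) ∂P ∂classLaw G a o ≤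
      ∫⁻ ω, φ ω.1 ∂P + ε n + ε n :=
    calc ∫⁻ c, ∫⁻ ω, φ (ω.1 + Measure.dirac c) ∂P ∂classLaw G a o
        = ∫⁻ ω, ∫⁻ c, φ (ω.1 + Measure.dirac c) ∂classLaw G a o ∂P :=
          (lintegral_lintegral_swap (f := fun (ω : Config G) c => φ (ω.1 + Measure.dirac c))
            (hφ.comp hP.measurable_add_dirac).aemeasurable).symm
      _ ≤ ∫⁻ ω, ∫⁻ c₁, ∫⁻ c₂, φ (ω.1 + Measure.dirac c₁ + Measure.dirac c₂)
            ∂mixLaw G a o n ∂mixLaw G a o n ∂P :=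
          lintegral_mono fun ω => htrans.lintegral_classLaw_le hEm hE hE_incr ω o n
      _ ≤ ∫⁻ ω, φ ω.1 ∂P + ε n + ε n :=
          hP.lintegral_add_dirac_add_dirac_le (htrans.mixLaw_le ha_symm o n) hφ
            (Set.indicator_le_self' (by simp))
  have hlim : Filter.Tendsto (fun n => ∫⁻ ω, φ ω.1 ∂P + ε n + ε n) Filter.atTop
      (nhds (∫⁻ ω, φ ω.1 ∂P)) := by
    simpa using (tendsto_const_nhds.add hε).add hε
  exact ge_of_tendsto' hlim hbound

lemma IsTransient.ae_addTraj_mem_iff (htrans : IsTransient G a)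
    (ha_symm : ∀ x y, a x y = a y x) {P : Measure (Config G)} (hP : IsInterlacementLaw G a P)
    (hEm : MeasurableSet E)
    (hE : MeasurableSet[unpairedTail G] (Subtype.val ⁻¹' E : Set (Config G)))
    (hE_incr : IsUpperSet (Subtype.val ⁻¹' E : Set (Config G))) :
    ∀ᵐ c ∂nu G a, ∀ᵐ ω ∂P, ω.1 + Measure.dirac c ∈ E ↔ ω.1 ∈ E := by
  have := hP.isProbabilityMeasure
  have hEm' : MeasurableSet (Subtype.val ⁻¹' E : Set (Config G)) := measurable_subtype_coe hEm
  have hadd (c : TrajMod G) : Measurable fun ω : Config G => ω.1 + Measure.dirac c :=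
    measurable_subtype_coe.add_const _
  have hsub (c : TrajMod G) : (Subtype.val ⁻¹' E : Set (Config G)) ⊆
      {ω | ω.1 + Measure.dirac c ∈ E} := fun ω hω => hE_incr (le_addTraj ω c) hω
  refine htrans.nu_absolutelyContinuous.ae_le (Measure.ae_sum_iff.2 fun o => ?_)
  have hconst : ∫⁻ _, P (Subtype.val ⁻¹' E) ∂classLaw G a o = P (Subtype.val ⁻¹' E) := by simp
  have hle : ∫⁻ c, P {ω | ω.1 + Measure.dirac c ∈ E} ∂classLaw G a o ≤ P (Subtype.val ⁻¹' E) := by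
    have h := htrans.lintegral_classLaw_add_dirac_le ha_symm hP hEm hE hE_incr o
    rw [← lintegral_indicator_one hEm']
    refine le_of_eq_of_le (lintegral_congr fun c => ?_) h
    exact (lintegral_indicator_one (hadd c hEm)).symm
  have hmeas : Measurable fun c => P {ω : Config G | ω.1 + Measure.dirac c ∈ E} :=
    measurable_measure_prodMk_right (hP.measurable_add_dirac hEm)
  have heq := ae_eq_of_ae_le_of_lintegral_le (ae_of_all _ fun c => measure_mono (hsub c))
    (by simp) hmeas.aemeasurable (hle.trans_eq hconst.symm)
  filter_upwards [heq] with c hc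
  exact (Filter.eventuallyEq_set.1 (ae_eq_of_subset_of_measure_ge (hsub c) hc.ge
    hEm'.nullMeasurableSet (measure_ne_top _ _))).mono fun ω hω => hω.symm

end ZeroOne

end

end Interlacement

open Interlacement in
theorem mainTheorem1_general {V : Type*} [Countable V] [MeasurableSpace V]
    [DiscreteMeasurableSpace V] (G : SimpleGraph V) [G.LocallyFinite]
    (a : V → V → ℝ≥0) (ha_symm : ∀ x y, a x y = a y x) (htrans : IsTransient G a)
    (P : Measure (Config G)) (hP : IsInterlacementLaw G a P) (E : Set (Config G))
    (hE : MeasurableSet[unpairedTail G] E) (hE_incr : IsUpperSet E) :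
    P E = 0 ∨ P E = 1 := by
  have := hP.sigmaFinite
  obtain ⟨E', hE', rfl⟩ := measurableSet_of_unpairedTail hE
  refine hP.zero_or_one_of_add_dirac hE' ?_
  rcases isEmpty_or_nonempty (TrajMod G) with _ | _
  · exact ae_of_all _ isEmptyElim
  · exact htrans.ae_addTraj_mem_iff ha_symm hP hE' hE hE_incr

theorem mainTheorem1 {V : Type*} [Countable V] [MeasurableSpace V] [DiscreteMeasurableSpace V]
    (G : SimpleGraph V) [G.LocallyFinite] (hG : G.Connected)
    (a : V → V → ℝ≥0) (ha_symm : ∀ x y, a x y = a y x) (ha_pos : ∀ x y, G.Adj x y → 0 < a x y)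
    (htrans : Interlacement.IsTransient G a)
    (P : Measure (Interlacement.Config G)) (hP : Interlacement.IsInterlacementLaw G a P)
    (E : Set (Interlacement.Config G))
    (hE : MeasurableSet[Interlacement.unpairedTail G] E) (hE_incr : IsUpperSet E) :
    P E = 0 ∨ P E = 1 :=
  mainTheorem1_general G a ha_symm htrans P hP E hE hE_incr
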